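/- **Theorem.** Let $G=(V,A)$ be a directed multigraph with two distinguished nodes $s,t$, and let $\mathcal X\subseteq\{0,1\}^A$ be the set of characteristic vectors of the simple $s$-$t$ paths in $G$. Let rational first-stage arc costs $C\in\mathbb Q^A$ be given, and $K\ge 1$ scenarios, where scenario $j\in\{1,\dots,K\}$ has rational probability $p_j>0$ and rational second-stage arc costs $c_j\in\mathbb Q^A$, with $\sum_j p_j=1$. A first-stage solution is a vector $x$ in $\mathcal X'=\{x\in\{0,1\}^A:\ \exists\, y\in\{0,1\}^A,\ x+y\in\mathcal X\}$; its recourse actions are the vectors in $\mathcal R(x)=\{y\in\{0,1\}^A:\ x+y\in\mathcal X\}$. The problem TSt-E Shortest Path with set $\mathcal X$ is to find a first-stage solution of least expected cost, $$\min_{x\in\mathcal X'}\ \sum_{j=1}^K p_j\Bigl(C^{\top}x+\min_{y\in\mathcal R(x)}c_j^{\top}y\Bigr).$$ Call $G$ series-parallel with source $s$ and sink $t$ if it can be built by the following rules: a single arc from $s$ to $t\neq s$ is series-parallel; from two disjoint series-parallel multigraphs one obtains another by identifying their sources and identifying their sinks (parallel composition), or by identifying the sink of the first with the source of the second (series composition).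 Then TSt-E Shortest Path with set $\mathcal X$ is polynomially solvable on series-parallel graphs: there is an algorithm which, for every instance whose graph $G$ is series-parallel with source $s$ and sink $t$ (given only by its list of arcs with their costs, the nodes $s$ and $t$, and the scenario probabilities, without a decomposition tree), computes an optimal first-stage solution together with the optimal value, in a number of steps bounded by a polynomial in the binary encoding length of the instance. -/

import Mathlib

/-! ### A machine model with a step count

Data are binary trees with integer leaves.  Programs are built from elementary operations by
composition, pairing, branching and while loops.  An elementary operation costs one step plus the
sizes (in bits) of its operand and of its result, so that numbers are charged logarithmically and
no data can be built, copied or inspected without paying for its full size.  Hence this model and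
Turing machines simulate each other with polynomial overhead. -/

/-- Data: binary trees with integers at the leaves. -/
inductive Data where
  | int (z : ℤ)
  | pair (a b : Data)

namespace Data

/-- The size of a datum: the number of bits of all its numbers, plus one for each constructor. -/
def size : Data → ℕ
  | int z => Nat.size z.natAbs + 1
  | pair a b => a.size + b.size + 1

/-- Lists are encoded as nested pairs, ended by `0`. -/
def ofList : List Data → Data
  | [] => int 0
  | a :: l => pair a (ofList l)

/-- A rational number is encoded by its numerator and its (positive) denominator
in lowest terms. -/
def ofRat (r : ℚ) : Data := pair (int r.num) (int r.den)

end Data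

/-- The elementary operations. -/
inductive Op where
  | id
  | const (z : ℤ)
  | fst
  | snd
  | isPair
  | add
  | sub
  | mul
  | le

/-- The effect of an elementary operation; ill-typed operands give `0`. -/
def Op.apply : Op → Data → Data
  | .id, v => v
  | .const z, _ => .int z
  | .fst, .pair a _ => a
  | .snd, .pair _ b => b
  | .isPair, .pair _ _ => .int 1
  | .add, .pair (.int a) (.int b) => .int (a + b)
  | .sub, .pair (.int a) (.int b) => .int (a - b)
  | .mul, .pair (.int a) (.int b) => .int (a * b)
  | .le, .pair (.int a) (.int b) => .int (if a ≤ b then 1 else 0)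
  | _, _ => .int 0

/-- Programs. -/
inductive Prog where
  /-- an elementary operation -/
  | op (o : Op)
  /-- `seq p q`: run `p`, then run `q` on its result -/
  | seq (p q : Prog)
  /-- `fork p q`: run `p` and `q` on the same input and pair the results -/
  | fork (p q : Prog)
  /-- `ite b p q`: if `b` returns something other than `0` on the input, run `p`, otherwise `q` -/
  | ite (b p q : Prog)
  /-- `loop b p`: as long as `b` returns something other than `0`, replace the input by the
  result of `p` -/
  | loop (b p : Prog)

/-- `Runs p v w k`: on input `v` the program `p` halts with output `w` after `k` steps. -/
inductive Runs : Prog → Data → Data → ℕ → Prop where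
  | op (o : Op) (v : Data) :
      Runs (.op o) v (o.apply v) (v.size + (o.apply v).size + 1)
  | seq {p q : Prog} {u v w : Data} {k l : ℕ} :
      Runs p u v k → Runs q v w l → Runs (.seq p q) u w (k + l + 1)
  | fork {p q : Prog} {u v w : Data} {k l : ℕ} :
      Runs p u v k → Runs q u w l → Runs (.fork p q) u (.pair v w) (k + l + 1)
  | ite_true {b p q : Prog} {u r w : Data} {k l : ℕ} :
      Runs b u r k → r ≠ .int 0 → Runs p u w l → Runs (.ite b p q) u w (k + l + 1)
  | ite_false {b p q : Prog} {u w : Data} {k l : ℕ} :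
      Runs b u (.int 0) k → Runs q u w l → Runs (.ite b p q) u w (k + l + 1)
  | loop_stop {b p : Prog} {u : Data} {k : ℕ} :
      Runs b u (.int 0) k → Runs (.loop b p) u u (k + 1)
  | loop_step {b p : Prog} {u r v w : Data} {k l m : ℕ} :
      Runs b u r k → r ≠ .int 0 → Runs p u v l → Runs (.loop b p) v w m →
        Runs (.loop b p) u w (k + l + m + 1)

/-- A computational problem, given by the encoding `enc` of its instances, the set `S` of the
instances under consideration, and the relation `Sol` between instances and correct outputs, is
polynomially solvable if one program returns a correct output for every instance in `S`, in a
number of steps that is bounded by a fixed polynomial in the size of the encoded instance. -/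
def PolynomiallySolvable {ι : Type} (enc : ι → Data) (S : Set ι) (Sol : ι → Data → Prop) : Prop :=
  ∃ (p : Prog) (q : Polynomial ℕ), ∀ I ∈ S, ∃ (w : Data) (k : ℕ),
    Runs p (enc I) w k ∧ k ≤ q.eval (enc I).size ∧ Sol I w

/-! ### Networks -/

/-- A directed multigraph with nodes `0, …, n - 1` and arcs `0, …, m - 1`, and with two
distinguished nodes `s` and `t`. -/
structure Network where
  n : ℕ
  m : ℕ
  tail : Fin m → Fin n
  head : Fin m → Fin n
  s : Fin n
  t : Fin n

namespace Network

/-- The arcs in the list lead, one after the other, from the first node to the second. -/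
def IsWalk (G : Network) : Fin G.n → List (Fin G.m) → Fin G.n → Prop
  | u, [], v => u = v
  | u, a :: l, v => G.tail a = u ∧ G.IsWalk (G.head a) l v

/-- A simple `s`-`t` path, as its list of arcs: no node is visited twice. -/
def IsSimplePath (G : Network) (l : List (Fin G.m)) : Prop :=
  G.IsWalk G.s l G.t ∧ (G.s :: l.map G.head).Nodup

/-- The feasible set `𝒳` of the shortest path problem: the arc sets of the simple `s`-`t` paths.
Here and below a 0-1 vector indexed by the arcs is identified with the set of arcs at which it
equals `1`. -/
def feasible (G : Network) : Set (Finset (Fin G.m)) :=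
  {P | ∃ l, G.IsSimplePath l ∧ l.toFinset = P}

/-- `G.IsSP W B u v`: the nodes in `W` and the arcs in `B` form a (two-terminal, directed)
series-parallel multigraph with source `u` and sink `v`.  Two disjoint multigraphs glued at
terminals are the same as two submultigraphs that have exactly these terminals in common. -/
inductive IsSP (G : Network) :
    Finset (Fin G.n) → Finset (Fin G.m) → Fin G.n → Fin G.n → Prop where
  | arc (a : Fin G.m) : G.tail a ≠ G.head a →
      IsSP G {G.tail a, G.head a} {a} (G.tail a) (G.head a)
  | series {W₁ W₂ : Finset (Fin G.n)} {B₁ B₂ : Finset (Fin G.m)} {u v w : Fin G.n} :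
      IsSP G W₁ B₁ u w → IsSP G W₂ B₂ w v → W₁ ∩ W₂ = {w} → Disjoint B₁ B₂ →
        IsSP G (W₁ ∪ W₂) (B₁ ∪ B₂) u v
  | parallel {W₁ W₂ : Finset (Fin G.n)} {B₁ B₂ : Finset (Fin G.m)} {u v : Fin G.n} :
      IsSP G W₁ B₁ u v → IsSP G W₂ B₂ u v → W₁ ∩ W₂ = {u, v} → Disjoint B₁ B₂ →
        IsSP G (W₁ ∪ W₂) (B₁ ∪ B₂) u v

/-- `G` is series-parallel with source `s` and sink `t`. -/
def SeriesParallel (G : Network) : Prop :=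
  G.IsSP Finset.univ Finset.univ G.s G.t

end Network

/-! ### The two-stage problem -/

/-- An instance of the two-stage stochastic shortest path problem: a network, first-stage arc
costs `C`, and `K` scenarios, where scenario `j` has probability `p j` and second-stage arc
costs `c j`. -/
structure TwoStageInstance extends Network where
  C : Fin m → ℚ
  K : ℕ
  c : Fin K → Fin m → ℚ
  p : Fin K → ℚ
  p_pos : ∀ j, 0 < p j
  p_sum : ∑ j, p j = 1

namespace TwoStageInstance

open Classical in
/-- The recourse actions `{y | x + y ∈ 𝒳}` for a first-stage decision `x`. -/
noncomputable def recourse (I : TwoStageInstance) (x : Finset (Fin I.m)) :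
    Finset (Finset (Fin I.m)) :=
  Finset.univ.filter fun y => Disjoint x y ∧ x ∪ y ∈ I.feasible

/-- The first-stage solutions `{x | ∃ y, x + y ∈ 𝒳}`. -/
def firstStage (I : TwoStageInstance) : Set (Finset (Fin I.m)) :=
  {x | (I.recourse x).Nonempty}

/-- The cost of `x` in scenario `j`: the first-stage cost of `x` plus the least second-stage cost
of a recourse action.  (It is only used for first-stage solutions `x`.) -/
noncomputable def cost (I : TwoStageInstance) (x : Finset (Fin I.m)) (j : Fin I.K) : ℚ :=
  ∑ a ∈ x, I.C a +
    if h : (I.recourse x).Nonempty then (I.recourse x).inf' h fun y => ∑ a ∈ y, I.c j a else 0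

/-- The expected cost of `x`. -/
noncomputable def expectedCost (I : TwoStageInstance) (x : Finset (Fin I.m)) : ℚ :=
  ∑ j, I.p j * I.cost x j

/-- `x` is an optimal first-stage solution for the expected cost. -/
def IsOptimal (I : TwoStageInstance) (x : Finset (Fin I.m)) : Prop :=
  x ∈ I.firstStage ∧ ∀ x' ∈ I.firstStage, I.expectedCost x ≤ I.expectedCost x'

/-- The input: the number of nodes, the nodes `s` and `t`, the list of the arcs (each with tail,
head, first-stage cost and the list of its second-stage costs), and the list of the
probabilities. -/
def encode (I : TwoStageInstance) : Data :=
  .pair (.int I.n) <|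
  .pair (.pair (.int (I.s : ℕ)) (.int (I.t : ℕ))) <|
  .pair
    (.ofList <| List.ofFn fun a : Fin I.m =>
      .pair (.pair (.int (I.tail a : ℕ)) (.int (I.head a : ℕ))) <|
      .pair (.ofRat (I.C a)) (.ofList <| List.ofFn fun j : Fin I.K => .ofRat (I.c j a)))
    (.ofList <| List.ofFn fun j : Fin I.K => .ofRat (I.p j))

/-- The output has to consist of the 0-1 vector of an optimal first-stage solution, and of the
optimal value, as a fraction. -/
def IsSolution (I : TwoStageInstance) (w : Data) : Prop :=
  ∃ (x : Finset (Fin I.m)) (a b : ℤ), I.IsOptimal x ∧ b ≠ 0 ∧ I.expectedCost x = a / b ∧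
    w = .pair (.ofList <| List.ofFn fun i : Fin I.m => .int (if i ∈ x then 1 else 0))
      (.pair (.int a) (.int b))

end TwoStageInstance

/-!
In an acyclic network every walk is a simple path, and all the paths that contain a given set `x`
of arcs traverse it in the same order. Between two consecutive arcs of `x` each scenario is free to
choose its own second-stage walk. So the expected cost of `x` is the length of a walk from `s` to
`t` that alternates between the arcs of `x`, with their first-stage costs, and *jumps*: a jump from
`u` to `v` costs the expectation of the scenarios' second-stage distances from `u` to `v`
(`TwoStageInstance.exists_reach_of_firstStage`). Conversely, the first-stage arcs of any walk with
jumps form a first-stage solution that costs no more than the walk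
(`TwoStageInstance.firstStage_of_reach`). The problem is therefore a shortest walk problem in
the network extended by an arc for each jump, whose costs come from shortest walk problems for the
single scenarios. All of these are solved by the algorithm of Bellman and Ford.

Series-parallel networks are acyclic: gluing potentials along a decomposition gives one that
increases along all arcs (`Network.IsSP.exists_rank`). The decomposition occurs only in this
proof, and the algorithm does not have to find it.

For the running time, the functions computed by programs in polynomial time (`PTime`) are shown to
be closed under composition, pairing, case distinction and those folds over lists whose states
remain polynomially small (`PTime.foldl`). The machine has no division, so fractions are never
reduced. They stay short all the same, since a distance is always extended by the cost of a single
arc, which makes its encoding grow only by an additive amount (`Frac.width_add_le`).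
-/

/-! ### Polynomial-time functions between encoded types -/

/-- A type whose elements are represented by data. Injectivity of the encoding is not needed. -/
class Enc (α : Type) where
  enc : α → Data

open Enc (enc)

/-- The size of the encoding. -/
def esize {α : Type} [Enc α] (a : α) : ℕ := (enc a).size

instance : Enc Data := ⟨fun d => d⟩
instance : Enc ℤ := ⟨Data.int⟩
instance : Enc ℕ := ⟨fun n => .int n⟩
instance : Enc Bool := ⟨fun b => .int (if b then 1 else 0)⟩
instance {α β : Type} [Enc α] [Enc β] : Enc (α × β) := ⟨fun x => .pair (enc x.1) (enc x.2)⟩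
instance {α : Type} [Enc α] : Enc (List α) := ⟨fun l => .ofList (l.map enc)⟩
instance {α : Type} [Enc α] : Enc (Option α) :=
  ⟨fun o => o.elim (.int 0) fun a => .pair (enc a) (.int 0)⟩
instance {α : Type} [Enc α] {P : α → Prop} : Enc {a // P a} := ⟨fun a => enc a.1⟩

/-- `f` is computed by a program whose number of steps is polynomial in the size of the argument.
For partial functions, `α` is taken to be a subtype. -/
def PTime {α β : Type} [Enc α] [Enc β] (f : α → β) : Prop :=
  ∃ (p : Prog) (q : Polynomial ℕ), ∀ a, ∃ k, Runs p (enc a) (enc (f a)) k ∧ k ≤ q.eval (esize a)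

theorem Polynomial.eval_nat_mono (q : Polynomial ℕ) {a b : ℕ} (h : a ≤ b) :
    q.eval a ≤ q.eval b := by
  induction q using Polynomial.induction_on' with
  | add p q hp hq => simpa using Nat.add_le_add hp hq
  | monomial n c => simp only [Polynomial.eval_monomial]; gcongr

theorem Data.size_pos (d : Data) : 0 < d.size := by cases d <;> simp [Data.size]

/-- A run pays for its input and for its output. -/
theorem Runs.size_le {p : Prog} {v w : Data} {k : ℕ} (h : Runs p v w k) :
    v.size ≤ k ∧ w.size ≤ k := by
  induction h with
  | op => omega
  | fork => simp only [Data.size]; omega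
  | _ => omega

section Size

variable {α β : Type} [Enc α] [Enc β]

theorem esize_pos (a : α) : 0 < esize a := Data.size_pos _

@[simp] theorem esize_pair (a : α) (b : β) : esize (a, b) = esize a + esize b + 1 := rfl

@[simp] theorem esize_nil : esize ([] : List α) = 1 := rfl

@[simp] theorem esize_cons (a : α) (l : List α) : esize (a :: l) = esize a + esize l + 1 := rfl

@[simp] theorem esize_none : esize (none : Option α) = 1 := rfl

@[simp] theorem esize_some (a : α) : esize (some a) = esize a + 2 := rfl

theorem esize_bool (b : Bool) : esize b ≤ 2 := by cases b <;> decide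

theorem esize_add_le_max (a b : ℤ) : esize (a + b) ≤ max (esize a) (esize b) + 1 := by
  have : Nat.size (a + b).natAbs ≤ max (Nat.size a.natAbs) (Nat.size b.natAbs) + 1 := by
    rw [Nat.size_le, pow_succ]
    have h1 := Int.natAbs_add_le a b
    have h2 := Nat.size_le.1 (le_max_left (Nat.size a.natAbs) (Nat.size b.natAbs))
    have h3 := Nat.size_le.1 (le_max_right (Nat.size a.natAbs) (Nat.size b.natAbs))
    omega
  change Nat.size _ + 1 ≤ max (Nat.size _ + 1) (Nat.size _ + 1) + 1
  omega

theorem esize_add_le (a b : ℤ) : esize (a + b) ≤ esize a + esize b := by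
  have := esize_add_le_max a b
  have := esize_pos a
  have := esize_pos b
  omega

theorem esize_mul_le (a b : ℤ) : esize (a * b) ≤ esize a + esize b := by
  have ha := Nat.lt_size_self a.natAbs
  have hb := Nat.lt_size_self b.natAbs
  have : Nat.size (a * b).natAbs ≤ Nat.size a.natAbs + Nat.size b.natAbs := by
    rw [Nat.size_le, Int.natAbs_mul, pow_add]
    exact Nat.mul_lt_mul'' ha hb
  change Nat.size _ + 1 ≤ (Nat.size _ + 1) + (Nat.size _ + 1)
  omega

theorem esize_append (l l' : List α) : esize (l ++ l') + 1 = esize l + esize l' := by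
  induction l with
  | nil => simp; omega
  | cons a l ih => simp; omega

theorem length_lt_esize (l : List α) : l.length < esize l := by
  induction l with
  | nil => simp
  | cons a l ih => simp; omega

theorem esize_le_of_mem {a : α} {l : List α} (h : a ∈ l) : esize a ≤ esize l := by
  induction l with
  | nil => simp at h
  | cons b l ih =>
    rcases List.mem_cons.1 h with rfl | h
    · simp; omega
    · have := ih h
      simp; omega

theorem esize_le_length_mul {l : List α} {B : ℕ} (h : ∀ a ∈ l, esize a ≤ B) :
    esize l ≤ l.length * (B + 1) + 1 := by
  induction l with
  | nil => simp
  | cons a l ih =>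
    have h1 := h a (by simp)
    have h2 := ih fun b hb => h b (by simp [hb])
    simp only [esize_cons, List.length_cons]
    linarith

end Size

namespace PTime

variable {α β γ δ σ : Type} [Enc α] [Enc β] [Enc γ] [Enc δ] [Enc σ]

theorem size_le {f : α → β} (hf : PTime f) :
    ∃ q : Polynomial ℕ, ∀ a, esize (f a) ≤ q.eval (esize a) := by
  obtain ⟨p, q, h⟩ := hf
  refine ⟨q, fun a => ?_⟩
  obtain ⟨k, hk, hq⟩ := h a
  exact hk.size_le.2.trans hq

/-- Only the encodings of arguments and values matter. -/
theorem of_enc_eq {f : α → β} {g : γ → δ} (hg : PTime g) (e : α → γ)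
    (he : ∀ a, enc (e a) = enc a) (h : ∀ a, enc (g (e a)) = enc (f a)) : PTime f := by
  obtain ⟨p, q, hp⟩ := hg
  refine ⟨p, q, fun a => ?_⟩
  obtain ⟨k, hk, hq⟩ := hp (e a)
  rw [he, h] at hk
  refine ⟨k, hk, ?_⟩
  have : esize (e a) = esize a := congrArg Data.size (he a)
  rwa [this] at hq

theorem comp {g : β → γ} {f : α → β} (hg : PTime g) (hf : PTime f) :
    PTime fun a => g (f a) := by
  obtain ⟨p, q, hp⟩ := hf
  obtain ⟨p', q', hp'⟩ := hg
  refine ⟨.seq p p', q + q'.comp q + 1, fun a => ?_⟩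
  obtain ⟨k, hk, hq⟩ := hp a
  obtain ⟨l, hl, hq'⟩ := hp' (f a)
  refine ⟨_, .seq hk hl, ?_⟩
  have := q'.eval_nat_mono (hk.size_le.2.trans hq)
  simp only [Polynomial.eval_add, Polynomial.eval_comp, Polynomial.eval_one]
  unfold esize at *
  omega

theorem pair {f : α → β} {g : α → γ} (hf : PTime f) (hg : PTime g) :
    PTime fun a => (f a, g a) := by
  obtain ⟨p, q, hp⟩ := hf
  obtain ⟨p', q', hp'⟩ := hg
  refine ⟨.fork p p', q + q' + 1, fun a => ?_⟩
  obtain ⟨k, hk, hq⟩ := hp a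
  obtain ⟨l, hl, hq'⟩ := hp' a
  refine ⟨_, .fork hk hl, ?_⟩
  simp only [Polynomial.eval_add, Polynomial.eval_one]
  omega

theorem of_op {f : α → β} (o : Op) (q : Polynomial ℕ) (h : ∀ a, o.apply (enc a) = enc (f a))
    (hq : ∀ a, esize (f a) ≤ q.eval (esize a)) : PTime f := by
  refine ⟨.op o, Polynomial.X + q + 1, fun a => ⟨_, h a ▸ Runs.op o (enc a), ?_⟩⟩
  have := hq a
  simp only [Polynomial.eval_add, Polynomial.eval_X, Polynomial.eval_one]
  unfold esize at *
  omega

theorem of_op_linear {f : α → β} (o : Op) (h : ∀ a, o.apply (enc a) = enc (f a))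
    (hq : ∀ a, esize (f a) ≤ esize a) : PTime f :=
  of_op o Polynomial.X h (by simpa using hq)

theorem id : PTime fun a : α => a := of_op_linear .id (fun _ => rfl) fun _ => le_rfl

theorem fst : PTime (Prod.fst : α × β → α) :=
  of_op_linear .fst (fun _ => rfl) fun a => by
    obtain ⟨a, b⟩ := a
    simp; omega

theorem snd : PTime (Prod.snd : α × β → β) :=
  of_op_linear .snd (fun _ => rfl) fun a => by
    obtain ⟨a, b⟩ := a
    simp; omega

theorem const (b : β) : PTime fun _ : α => b := by
  have (d : Data) : PTime fun _ : α => d := by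
    induction d with
    | int z =>
      exact of_op (.const z) (Polynomial.C (Data.int z).size) (fun _ => rfl) fun _ => by
        simp [esize, enc]
    | pair a b ha hb => exact of_enc_eq (ha.pair hb) (fun a => a) (fun _ => rfl) fun _ => rfl
  exact of_enc_eq (this (enc b)) (fun a => a) (fun _ => rfl) fun _ => rfl

theorem val {P : α → Prop} : PTime (Subtype.val : {a // P a} → α) :=
  of_enc_eq (id (α := α)) Subtype.val (fun _ => rfl) fun _ => rfl

theorem add {f g : α → ℤ} (hf : PTime f) (hg : PTime g) : PTime fun a => f a + g a :=
  (of_op_linear (f := fun x : ℤ × ℤ => x.1 + x.2) .add (fun _ => rfl) fun x => by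
    have := esize_add_le x.1 x.2
    change _ ≤ esize x.1 + esize x.2 + 1
    omega).comp (hf.pair hg)

theorem mul {f g : α → ℤ} (hf : PTime f) (hg : PTime g) : PTime fun a => f a * g a :=
  (of_op_linear (f := fun x : ℤ × ℤ => x.1 * x.2) .mul (fun _ => rfl) fun x => by
    have := esize_mul_le x.1 x.2
    change _ ≤ esize x.1 + esize x.2 + 1
    omega).comp (hf.pair hg)

theorem le {f g : α → ℤ} (hf : PTime f) (hg : PTime g) : PTime fun a => decide (f a ≤ g a) :=
  (of_op_linear (f := fun x : ℤ × ℤ => decide (x.1 ≤ x.2)) .le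
    (fun x => by simp [enc, Op.apply]) fun x => by
      have := esize_bool (decide (x.1 ≤ x.2))
      change _ ≤ esize x.1 + esize x.2 + 1
      have := esize_pos x.1
      have := esize_pos x.2
      omega).comp (hf.pair hg)

theorem natCast {f : α → ℕ} (hf : PTime f) : PTime fun a => (f a : ℤ) :=
  of_enc_eq hf (fun a => a) (fun _ => rfl) fun _ => rfl

theorem of_natCast {f : α → ℕ} (hf : PTime fun a => (f a : ℤ)) : PTime f :=
  of_enc_eq hf (fun a => a) (fun _ => rfl) fun _ => rfl

/-- Case distinction; each branch only has to be correct on the arguments that reach it. -/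
theorem cases {f : α → β} {b : α → Bool} (hb : PTime b)
    (h1 : PTime fun a : {a // b a = true} => f a.1)
    (h0 : PTime fun a : {a // b a = false} => f a.1) : PTime f := by
  obtain ⟨p, q, hp⟩ := hb
  obtain ⟨p1, q1, hp1⟩ := h1
  obtain ⟨p0, q0, hp0⟩ := h0
  refine ⟨.ite p p1 p0, q + q1 + q0 + 1, fun a => ?_⟩
  obtain ⟨k, hk, hq⟩ := hp a
  simp only [Polynomial.eval_add, Polynomial.eval_one]
  cases h : b a with
  | true =>
    obtain ⟨l, hl, hq'⟩ := hp1 ⟨a, h⟩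
    refine ⟨_, .ite_true hk (by simp [enc, h]) hl, ?_⟩
    have : l ≤ q1.eval (esize a) := hq'
    omega
  | false =>
    obtain ⟨l, hl, hq'⟩ := hp0 ⟨a, h⟩
    refine ⟨_, .ite_false (by simpa [enc, h] using hk) hl, ?_⟩
    have : l ≤ q0.eval (esize a) := hq'
    omega

theorem ite {P : α → Prop} [DecidablePred P] {f g : α → β} (hP : PTime fun a => decide (P a))
    (hf : PTime f) (hg : PTime g) : PTime fun a => if P a then f a else g a :=
  cases hP
    (of_enc_eq (hf.comp val) (fun a => a) (fun _ => rfl) fun a => by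
      rw [if_pos (by simpa using a.2)])
    (of_enc_eq (hg.comp val) (fun a => a) (fun _ => rfl) fun a => by
      rw [if_neg (by simpa using a.2)])

theorem and {P Q : α → Prop} [DecidablePred P] [DecidablePred Q] (hP : PTime fun a => decide (P a))
    (hQ : PTime fun a => decide (Q a)) : PTime fun a => decide (P a ∧ Q a) :=
  of_enc_eq (ite hP hQ (const false)) (fun a => a) (fun _ => rfl) fun a => by
    by_cases h : P a <;> simp [h]

theorem natEq {f g : α → ℕ} (hf : PTime f) (hg : PTime g) : PTime fun a => decide (f a = g a) :=
  of_enc_eq ((le hf.natCast hg.natCast).and (le hg.natCast hf.natCast)) (fun a => a)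
    (fun _ => rfl) fun a => by
      congr 2
      simp only [Nat.cast_le, eq_iff_iff]
      omega

theorem some {f : α → β} (hf : PTime f) : PTime fun a => some (f a) :=
  of_enc_eq (hf.pair (const (0 : ℤ))) (fun a => a) (fun _ => rfl) fun _ => rfl

theorem optionElim {o : γ → Option α} {g : γ → β} {h : γ → α → β} (ho : PTime o) (hg : PTime g)
    (hh : PTime fun x : γ × α => h x.1 x.2) : PTime fun c => (o c).elim (g c) (h c) := by
  have hs : PTime fun c => (o c).isSome :=
    (of_op (f := fun x : Option α => x.isSome) .isPair (Polynomial.C 2)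
      (fun x => by cases x <;> rfl) (fun x => by simpa using esize_bool _)).comp ho
  refine cases hs ?_ ?_
  · -- In this branch there is a value, and it is the first component of the encoding.
    have hget : PTime fun c : {c // (o c).isSome = true} => (o c.1).get c.2 := by
      refine of_enc_eq ((of_op_linear (f := fun x : {x : Option α // x.isSome} => x.1.get x.2) .fst
        ?_ ?_).comp (of_enc_eq (ho.comp val) (fun c => c) (fun _ => rfl) fun _ => rfl :
          PTime fun c : {c // (o c).isSome = true} => (⟨o c.1, c.2⟩ : {x : Option α // x.isSome})))
        (fun c => c) (fun _ => rfl) fun _ => rfl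
      · rintro ⟨_ | a, h⟩
        · simp at h
        · rfl
      · rintro ⟨_ | a, h⟩
        · simp at h
        · exact Nat.le_add_right (esize a) 2
    refine of_enc_eq (hh.comp (val.pair hget)) (fun c => c) (fun _ => rfl) fun c => ?_
    obtain ⟨a, ha⟩ := Option.isSome_iff_exists.1 c.2
    simp [ha]
  · refine of_enc_eq (hg.comp val) (fun c => c) (fun _ => rfl) fun c => ?_
    have : o c.1 = none := by simpa using c.2
    simp [this]

theorem optionMap {o : γ → Option α} {h : γ → α → β} (ho : PTime o)
    (hh : PTime fun x : γ × α => h x.1 x.2) : PTime fun c => (o c).map (h c) :=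
  of_enc_eq (optionElim (h := fun c a => Option.some (h c a)) ho (const none) hh.some)
    (fun c => c) (fun _ => rfl) fun c => by cases o c <;> rfl

theorem optionBind {o : γ → Option α} {h : γ → α → Option β} (ho : PTime o)
    (hh : PTime fun x : γ × α => h x.1 x.2) : PTime fun c => (o c).bind (h c) :=
  of_enc_eq (optionElim (h := h) ho (const none) hh)
    (fun c => c) (fun _ => rfl) fun c => by cases o c <;> rfl

theorem cons {f : γ → α} {g : γ → List α} (hf : PTime f) (hg : PTime g) :
    PTime fun c => f c :: g c :=
  of_enc_eq (hf.pair hg) (fun a => a) (fun _ => rfl) fun _ => rfl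

/-! ### Folds -/

/-- A loop that applies the step function `h` to the state while the list is not empty. If `N`
bounds the size of all configurations, each of its rounds costs a polynomial in `N`. -/
theorem runs_loop_foldl {h : γ → σ → α → σ} {b p : Prog} {qb qp : Polynomial ℕ}
    (hb : ∀ x : γ × σ × List α, ∃ k, Runs b (enc x) (enc (!x.2.2.isEmpty)) k ∧
      k ≤ qb.eval (esize x))
    (hp : ∀ c s a l, ∃ k, Runs p (enc (c, s, a :: l)) (enc (c, h c s a, l)) k ∧
      k ≤ qp.eval (esize (c, s, a :: l)))
    (c : γ) (N : ℕ) (l : List α) : ∀ s : σ,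
    (∀ l₁ l₂, l = l₁ ++ l₂ → esize (c, l₁.foldl (h c) s, l₂) ≤ N) →
      ∃ k, Runs (.loop b p) (enc (c, s, l)) (enc (c, l.foldl (h c) s, ([] : List α))) k ∧
        k ≤ (l.length + 1) * (qb.eval N + qp.eval N + 1) := by
  induction l with
  | nil =>
    intro s hN
    obtain ⟨k, hk, hq⟩ := hb (c, s, [])
    refine ⟨_, Runs.loop_stop hk, ?_⟩
    have := qb.eval_nat_mono (hN [] [] rfl)
    simp only [List.foldl_nil, List.length_nil] at *
    omega
  | cons a l ih =>
    intro s hN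
    obtain ⟨k, hk, hq⟩ := hb (c, s, a :: l)
    obtain ⟨k', hk', hq'⟩ := hp c s a l
    obtain ⟨k'', hk'', hq''⟩ := ih (h c s a) fun l₁ l₂ hl => hN (a :: l₁) l₂ (by simp [hl])
    refine ⟨_, .loop_step hk (by simp [enc]) hk' hk'', ?_⟩
    have h1 := qb.eval_nat_mono (hN [] (a :: l) rfl)
    have h2 := qp.eval_nat_mono (hN [] (a :: l) rfl)
    simp only [List.foldl_nil, List.length_cons] at *
    linarith

/-- A fold is polynomial if its step function is and if the states do not grow too much. -/
theorem foldl {f : γ → List α} {g : γ → σ} {h : γ → σ → α → σ} (hf : PTime f) (hg : PTime g)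
    (hh : PTime fun x : γ × σ × α => h x.1 x.2.1 x.2.2)
    (hs : ∃ q : Polynomial ℕ, ∀ c (l : List α),
      esize (l.foldl (h c) (g c)) ≤ q.eval (esize c + esize l)) :
    PTime fun c => (f c).foldl (h c) (g c) := by
  have hb : PTime fun x : γ × σ × List α => !x.2.2.isEmpty :=
    (of_op (f := fun x : List α => !x.isEmpty) .isPair (Polynomial.C 2)
      (fun x => by cases x <;> rfl) (fun x => by simpa using esize_bool _)).comp
      (snd.comp snd)
  -- The body of the loop. A nonempty list is encoded as the pair of its head and its tail.
  have hp : PTime fun x : γ × σ × α × List α => (x.1, h x.1 x.2.1 x.2.2.1, x.2.2.2) :=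
    fst.pair ((hh.comp (fst.pair ((fst.comp snd).pair (fst.comp (snd.comp snd))))).pair
      (snd.comp (snd.comp snd)))
  obtain ⟨b, qb, hb⟩ := hb
  obtain ⟨p, qp, hp⟩ := hp
  obtain ⟨qs, hs⟩ := hs
  let X := {x : γ × σ × List α // x.2.1 = g x.1 ∧ x.2.2 = f x.1}
  have hloop : PTime fun x : X => (x.1.1, x.1.2.2.foldl (h x.1.1) x.1.2.1, ([] : List α)) := by
    let Q : Polynomial ℕ := Polynomial.X + qs + 1
    refine ⟨.loop b p, (Polynomial.X + 1) * (qb.comp Q + qp.comp Q + 1), ?_⟩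
    rintro ⟨⟨c, s, l⟩, hc, -⟩
    have hc : s = g c := hc
    obtain ⟨k, hk, hq⟩ := runs_loop_foldl (h := h) hb (fun c s a l => hp (c, s, a, l)) c
      (Q.eval (esize (c, s, l))) l s fun l₁ l₂ hl => by
        have h1 := hs c l₁
        have h2 := esize_append l₁ l₂
        have h3 := esize_pos l₁
        have h4 := esize_pos l₂
        have h5 : esize c + esize l₁ ≤ esize (c, s, l) := by
          simp only [esize_pair, hl]; omega
        have h6 := qs.eval_nat_mono h5
        have h7 := esize_pos s
        rw [← hc] at h1
        simp only [Q, Polynomial.eval_add, Polynomial.eval_X, Polynomial.eval_one]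
        simp only [esize_pair, hl] at h6 ⊢
        omega
    refine ⟨k, hk, hq.trans ?_⟩
    have hl : l.length ≤ esize (c, s, l) := by
      have := length_lt_esize l
      simp only [esize_pair]; omega
    simp only [Polynomial.eval_mul, Polynomial.eval_add, Polynomial.eval_comp, Polynomial.eval_X,
      Polynomial.eval_one]
    exact Nat.mul_le_mul_right _ (Nat.add_le_add_right hl 1)
  have hstart : PTime fun c => (⟨(c, g c, f c), rfl, rfl⟩ : X) :=
    of_enc_eq (id.pair (hg.pair hf)) (fun c => c) (fun _ => rfl) fun _ => rfl
  exact fst.comp (snd.comp (hloop.comp hstart))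

/-- A fold is polynomial if some measure `μ` bounds the size of the state, and each step adds an
amount to it that does not depend on the state. -/
theorem foldl_of_measure {f : γ → List α} {g : γ → σ} {h : γ → σ → α → σ} (μ : σ → ℕ)
    (hf : PTime f) (hg : PTime g) (hh : PTime fun x : γ × σ × α => h x.1 x.2.1 x.2.2)
    (hμ : ∃ q : Polynomial ℕ, ∀ s, esize s ≤ q.eval (μ s))
    (h0 : ∃ q : Polynomial ℕ, ∀ c, μ (g c) ≤ q.eval (esize c))
    (hs : ∃ q : Polynomial ℕ, ∀ c s a, μ (h c s a) ≤ μ s + q.eval (esize c + esize a)) :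
    PTime fun c => (f c).foldl (h c) (g c) := by
  obtain ⟨q, hq⟩ := hs
  obtain ⟨qg, hqg⟩ := h0
  obtain ⟨qμ, hqμ⟩ := hμ
  refine foldl hf hg hh ⟨qμ.comp (qg + Polynomial.X * q), fun c l => (hqμ _).trans ?_⟩
  rw [Polynomial.eval_comp]
  refine qμ.eval_nat_mono ?_
  have (l' : List α) (hl' : esize l' ≤ esize l) : ∀ s,
      μ (l'.foldl (h c) s) ≤ μ s + l'.length * q.eval (esize c + esize l) := by
    induction l' with
    | nil => simp
    | cons a l' ih =>
      intro s
      simp only [esize_cons] at hl'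
      have h1 := ih (by omega) (h c s a)
      have h2 := hq c s a
      have h3 := q.eval_nat_mono (show esize c + esize a ≤ esize c + esize l by omega)
      simp only [List.foldl_cons, List.length_cons]
      linarith
  have h1 := this l le_rfl (g c)
  have h2 := hqg c
  have h3 := qg.eval_nat_mono (show esize c ≤ esize c + esize l by omega)
  have h4 : l.length ≤ esize c + esize l := by have := length_lt_esize l; omega
  have h5 := Nat.mul_le_mul_right (q.eval (esize c + esize l)) h4
  simp only [Polynomial.eval_add, Polynomial.eval_mul, Polynomial.eval_X]
  omega

theorem foldl_of_growth {f : γ → List α} {g : γ → σ} {h : γ → σ → α → σ} (hf : PTime f)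
    (hg : PTime g) (hh : PTime fun x : γ × σ × α => h x.1 x.2.1 x.2.2)
    (hs : ∃ q : Polynomial ℕ, ∀ c s a, esize (h c s a) ≤ esize s + q.eval (esize c + esize a)) :
    PTime fun c => (f c).foldl (h c) (g c) :=
  foldl_of_measure esize hf hg hh ⟨Polynomial.X, by simp⟩ hg.size_le hs

theorem reverse {f : γ → List α} (hf : PTime f) : PTime fun c => (f c).reverse := by
  refine of_enc_eq (foldl_of_growth (h := fun _ (s : List α) a => a :: s) hf (const [])
    ((snd.comp snd).cons (fst.comp snd))
    ⟨Polynomial.X + 1, fun c s a => ?_⟩) (fun c => c) (fun _ => rfl) fun c => ?_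
  · simp; omega
  · simp

theorem foldr_of_growth {f : γ → List α} {g : γ → σ} {h : γ → α → σ → σ} (hf : PTime f)
    (hg : PTime g) (hh : PTime fun x : γ × α × σ => h x.1 x.2.1 x.2.2)
    (hs : ∃ q : Polynomial ℕ, ∀ c a s, esize (h c a s) ≤ esize s + q.eval (esize c + esize a)) :
    PTime fun c => (f c).foldr (h c) (g c) := by
  obtain ⟨q, hq⟩ := hs
  refine of_enc_eq (foldl_of_growth (h := fun c s a => h c a s) hf.reverse hg
    (hh.comp (fst.pair ((snd.comp snd).pair (fst.comp snd)))) ⟨q, fun c s a => hq c a s⟩)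
    (fun c => c) (fun _ => rfl) fun c => ?_
  simp

theorem append {f g : γ → List α} (hf : PTime f) (hg : PTime g) : PTime fun c => f c ++ g c := by
  refine of_enc_eq (foldr_of_growth (h := fun _ a (s : List α) => a :: s) hf hg
    ((fst.comp snd).cons (snd.comp snd)) ⟨Polynomial.X + 1, fun c a s => ?_⟩)
    (fun c => c) (fun _ => rfl) fun c => ?_
  · simp; omega
  · simp

theorem flatMap {f : γ → List α} {h : γ → α → List β} (hf : PTime f)
    (hh : PTime fun x : γ × α => h x.1 x.2) : PTime fun c => (f c).flatMap (h c) := by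
  obtain ⟨q, hq⟩ := hh.size_le
  refine of_enc_eq (foldr_of_growth (h := fun c a (s : List β) => h c a ++ s) hf (const [])
    ((hh.comp (fst.pair (fst.comp snd))).append (snd.comp snd))
    ⟨q.comp (Polynomial.X + 1), fun c a s => ?_⟩) (fun c => c) (fun _ => rfl) fun c => ?_
  · have := hq (c, a)
    have := esize_append (h c a) s
    simp at *; omega
  · congr 1
    induction f c with
    | nil => rfl
    | cons a l ih => simp [ih]

theorem filterMap {f : γ → List α} {h : γ → α → Option β} (hf : PTime f)
    (hh : PTime fun x : γ × α => h x.1 x.2) : PTime fun c => (f c).filterMap (h c) :=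
  of_enc_eq (flatMap (h := fun c a => (h c a).elim [] fun b => [b]) hf
    (optionElim hh (const []) (snd.cons (const [])))) (fun c => c) (fun _ => rfl) fun c => by
      congr 1
      induction f c with
      | nil => rfl
      | cons a l ih => cases h' : h c a <;> simp [ih, h']

theorem map {f : γ → List α} {h : γ → α → β} (hf : PTime f)
    (hh : PTime fun x : γ × α => h x.1 x.2) : PTime fun c => (f c).map (h c) :=
  of_enc_eq (filterMap (h := fun c a => Option.some (h c a)) hf hh.some)
    (fun c => c) (fun _ => rfl) fun c => by
      simp

theorem succ {f : α → ℕ} (hf : PTime f) : PTime fun a => f a + 1 :=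
  of_natCast (of_enc_eq (hf.natCast.add (const 1)) (fun a => a) (fun _ => rfl) fun a => by simp)

theorem esize_succ_le (n : ℕ) : esize (n + 1) ≤ esize n + 2 := by
  have := esize_add_le n 1
  have h : esize (1 : ℤ) = 2 := by decide
  have e : esize (n + 1) = esize ((n : ℤ) + 1) := by
    unfold esize; simp [enc]
  have e' : esize n = esize (n : ℤ) := rfl
  omega

theorem zipIdx {f : γ → List α} {i : ℕ} (hf : PTime f) : PTime fun c => (f c).zipIdx i := by
  let h : ℕ × List (α × ℕ) → α → ℕ × List (α × ℕ) := fun s a => (s.1 + 1, (a, s.1) :: s.2)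
  have hsize (l : List α) : ∀ s, esize (l.foldl h s) ≤
      esize s + esize l + l.length * (2 * l.length + esize s.1 + 6) := by
    induction l with
    | nil => simp
    | cons a l ih =>
      rintro ⟨n, t⟩
      have h1 := ih (n + 1, (a, n) :: t)
      have h2 := esize_succ_le n
      have h3 := Nat.mul_le_mul_left l.length
        (show 2 * l.length + esize (n + 1) + 6 ≤ 2 * l.length + (esize n + 2) + 6 by omega)
      simp only [esize_pair, esize_cons, List.foldl_cons, List.length_cons, h] at *
      linarith
  have heq (l : List α) : ∀ i t, (l.foldl h (i, t)).2.reverse = t.reverse ++ l.zipIdx i := by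
    induction l with
    | nil => simp
    | cons a l ih => intro i t; simp [h, ih, List.zipIdx_cons]
  -- The counter grows with the number of steps, so the growth of the state is not uniform.
  have key : PTime fun c => (f c).foldl h (i, []) := by
    refine foldl (h := fun _ => h) hf (const _) ?_ ?_
    · exact (succ (fst.comp (fst.comp snd))).pair
        (((snd.comp snd).pair (fst.comp (fst.comp snd))).cons (snd.comp (fst.comp snd)))
    · refine ⟨Polynomial.C (esize i) + 2 + Polynomial.X +
        Polynomial.X * (2 * Polynomial.X + Polynomial.C (esize i) + 6), fun c l => ?_⟩
      have h1 := hsize l (i, [])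
      have h2 := length_lt_esize l
      have h3 : l.length * (2 * l.length + esize i + 6) ≤
        (esize c + esize l) * (2 * (esize c + esize l) + esize i + 6) := by
        gcongr <;> omega
      simp only [esize_pair, esize_nil, Polynomial.eval_add, Polynomial.eval_mul,
        Polynomial.eval_X, Polynomial.eval_C, Polynomial.eval_ofNat] at *
      omega
  exact of_enc_eq (reverse (snd.comp key)) (fun c => c) (fun _ => rfl) fun c => by
    rw [heq]; rfl

end PTime

/-! ### Fractions -/

/-- Fractions that are not reduced to lowest terms: the machine has no division. -/
structure Frac where
  num : ℤ
  den : ℤ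
  den_pos : 0 < den

namespace Frac

instance : Enc Frac := ⟨fun x => .pair (.int x.num) (.int x.den)⟩

/-- The rational number that a fraction stands for. -/
def val (x : Frac) : ℚ := x.num / x.den

instance : Zero Frac := ⟨⟨0, 1, one_pos⟩⟩

instance : Add Frac :=
  ⟨fun x y => ⟨x.num * y.den + y.num * x.den, x.den * y.den, mul_pos x.den_pos y.den_pos⟩⟩

instance : Mul Frac := ⟨fun x y => ⟨x.num * y.num, x.den * y.den, mul_pos x.den_pos y.den_pos⟩⟩

/-- The order of the values, by cross-multiplication. -/
def Le (x y : Frac) : Prop := x.num * y.den ≤ y.num * x.den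

instance (x y : Frac) : Decidable (x.Le y) := inferInstanceAs (Decidable (_ ≤ _))

/-- A rational number as a fraction. -/
def ofRat (r : ℚ) : Frac := ⟨r.num, r.den, by exact_mod_cast r.den_pos⟩

@[simp] theorem val_zero : (0 : Frac).val = 0 := by
  change ((0 : ℤ) : ℚ) / _ = 0
  simp

@[simp] theorem val_add (x y : Frac) : (x + y).val = x.val + y.val := by
  have hx : (x.den : ℚ) ≠ 0 := by exact_mod_cast x.den_pos.ne'
  have hy : (y.den : ℚ) ≠ 0 := by exact_mod_cast y.den_pos.ne'
  change ((x.num * y.den + y.num * x.den : ℤ) : ℚ) / ((x.den * y.den : ℤ) : ℚ) =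
    x.num / x.den + y.num / y.den
  push_cast
  field_simp

@[simp] theorem val_mul (x y : Frac) : (x * y).val = x.val * y.val := by
  change ((x.num * y.num : ℤ) : ℚ) / ((x.den * y.den : ℤ) : ℚ) = x.num / x.den * (y.num / y.den)
  push_cast
  rw [div_mul_div_comm]

theorem le_iff {x y : Frac} : x.Le y ↔ x.val ≤ y.val := by
  have hx : (0 : ℚ) < x.den := by exact_mod_cast x.den_pos
  have hy : (0 : ℚ) < y.den := by exact_mod_cast y.den_pos
  unfold val Le
  rw [div_le_div_iff₀ hx hy]
  exact_mod_cast Iff.rfl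

@[simp] theorem val_ofRat (r : ℚ) : (ofRat r).val = r := by
  simpa [val, ofRat] using r.num_div_den

/-- The length of the longer one of numerator and denominator. In contrast to the encoding length,
it is subadditive up to a constant, so that sums of fractions stay short. -/
def width (x : Frac) : ℕ := max (esize x.num) (esize x.den)

theorem esize_eq (x : Frac) : esize x = esize x.num + esize x.den + 1 := rfl

theorem width_le_esize (x : Frac) : x.width ≤ esize x := by
  rw [esize_eq, width]; omega

theorem esize_le_width (x : Frac) : esize x ≤ 2 * x.width + 1 := by
  rw [esize_eq, width]; omega

theorem width_add_le (x y : Frac) : (x + y).width ≤ x.width + y.width + 1 := by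
  have h1 : esize (x + y).num ≤ max (esize (x.num * y.den)) (esize (y.num * x.den)) + 1 :=
    esize_add_le_max _ _
  have h2 : esize (x + y).den ≤ esize x.den + esize y.den := esize_mul_le _ _
  have h3 := esize_mul_le x.num y.den
  have h4 := esize_mul_le y.num x.den
  unfold width
  omega

end Frac

namespace PTime

variable {α β γ : Type} [Enc α] [Enc β] [Enc γ]

theorem fracNum {f : α → Frac} (hf : PTime f) : PTime fun a => (f a).num :=
  of_enc_eq ((fst (α := ℤ) (β := ℤ)).comp (of_enc_eq (f := fun a => ((f a).num, (f a).den)) hf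
    (fun a => a) (fun _ => rfl) fun _ => rfl)) (fun a => a) (fun _ => rfl) fun _ => rfl

theorem fracDen {f : α → Frac} (hf : PTime f) : PTime fun a => (f a).den :=
  of_enc_eq ((snd (α := ℤ) (β := ℤ)).comp (of_enc_eq (f := fun a => ((f a).num, (f a).den)) hf
    (fun a => a) (fun _ => rfl) fun _ => rfl)) (fun a => a) (fun _ => rfl) fun _ => rfl

theorem fracMk {f : α → Frac} (h1 : PTime fun a => (f a).num) (h2 : PTime fun a => (f a).den) :
    PTime f :=
  of_enc_eq (h1.pair h2) (fun a => a) (fun _ => rfl) fun _ => rfl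

theorem fracAdd {f g : α → Frac} (hf : PTime f) (hg : PTime g) : PTime fun a => f a + g a :=
  fracMk ((hf.fracNum.mul hg.fracDen).add (hg.fracNum.mul hf.fracDen)) (hf.fracDen.mul hg.fracDen)

theorem fracMul {f g : α → Frac} (hf : PTime f) (hg : PTime g) : PTime fun a => f a * g a :=
  fracMk (hf.fracNum.mul hg.fracNum) (hf.fracDen.mul hg.fracDen)

theorem fracLe {f g : α → Frac} (hf : PTime f) (hg : PTime g) :
    PTime fun a => decide ((f a).Le (g a)) :=
  le (hf.fracNum.mul hg.fracDen) (hg.fracNum.mul hf.fracDen)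

end PTime

/-! ### Shortest walks -/

/-- A weighted arc, with a number that identifies it. -/
structure Edge where
  tail : ℕ
  head : ℕ
  weight : Frac
  tag : ℕ

/-- A walk from a fixed node to `node`, represented by its length and by the tags of its arcs. -/
structure Label where
  node : ℕ
  dist : Frac
  tags : List ℕ

instance : Enc Edge := ⟨fun e => enc (e.tail, e.head, e.weight, e.tag)⟩
instance : Enc Label := ⟨fun l => enc (l.node, l.dist, l.tags)⟩

/-- The shortest one of the walks to `v` in a list. -/
def bestAt (v : ℕ) (T : List Label) : Option Label :=
  T.foldl (fun acc l => if l.node = v then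
    acc.elim (some l) fun b => if l.dist.Le b.dist then some l else some b else acc) none

/-- One round of the algorithm of Bellman and Ford. -/
def relax (E : List Edge) (s : ℕ) (T : List Label) : List Label :=
  ⟨s, 0, []⟩ :: E.filterMap fun e =>
    (bestAt e.tail T).map fun l => ⟨e.head, l.dist + e.weight, e.tag :: l.tags⟩

/-- The algorithm of Bellman and Ford from `s`; the number of rounds is the length of `fuel`. -/
def bellmanFord (E : List Edge) (s : ℕ) (fuel : List ℕ) : List Label :=
  fuel.foldl (fun T _ => relax E s T) [⟨s, 0, []⟩]

theorem bestAt_concat (v : ℕ) (T : List Label) (l : Label) :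
    bestAt v (T ++ [l]) = if l.node = v then
      (bestAt v T).elim (some l) fun b => if l.dist.Le b.dist then some l else some b
      else bestAt v T := by
  simp [bestAt]

theorem mem_of_bestAt {v : ℕ} {T : List Label} : ∀ {b : Label}, bestAt v T = some b →
    b ∈ T ∧ b.node = v := by
  induction T using List.reverseRecOn with
  | nil => simp [bestAt]
  | append_singleton T l ih =>
    intro b
    rw [bestAt_concat]
    split_ifs with h
    · cases hT : bestAt v T with
      | none =>
        simp only [Option.elim_none, Option.some.injEq]
        rintro rfl
        simp [h]
      | some c =>
        simp only [Option.elim_some]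
        split_ifs
        · simp only [Option.some.injEq]
          rintro rfl
          simp [h]
        · intro hb
          have := ih (hT.trans hb)
          exact ⟨by simp [this.1], this.2⟩
    · intro hb
      have := ih hb
      exact ⟨by simp [this.1], this.2⟩

theorem exists_bestAt_le {T : List Label} {l : Label} (hl : l ∈ T) :
    ∃ b, bestAt l.node T = some b ∧ b.dist.val ≤ l.dist.val := by
  induction T using List.reverseRecOn with
  | nil => simp at hl
  | append_singleton T l' ih =>
    rw [bestAt_concat]
    rcases List.mem_append.1 hl with hl | hl
    · obtain ⟨b, hb, hle⟩ := ih hl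
      rw [hb]
      split_ifs with h
      · simp only [Option.elim_some]
        split_ifs with h'
        · exact ⟨_, rfl, (Frac.le_iff.1 h').trans hle⟩
        · exact ⟨_, rfl, hle⟩
      · exact ⟨_, rfl, hle⟩
    · obtain rfl : l = l' := by simpa using hl
      rw [if_pos rfl]
      cases bestAt l.node T with
      | none => exact ⟨_, rfl, le_rfl⟩
      | some c =>
        simp only [Option.elim_some]
        split_ifs with h'
        · exact ⟨_, rfl, le_rfl⟩
        · exact ⟨_, rfl, (not_le.1 (mt Frac.le_iff.2 h')).le⟩

theorem mem_relax {E : List Edge} {s : ℕ} {T : List Label} {l : Label} :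
    l ∈ relax E s T ↔ l = ⟨s, 0, []⟩ ∨ ∃ e ∈ E, ∃ b, bestAt e.tail T = some b ∧
      l = ⟨e.head, b.dist + e.weight, e.tag :: b.tags⟩ := by
  simp only [relax, List.mem_cons, List.mem_filterMap, Option.map_eq_some_iff, eq_comm (a := l)]

theorem bellmanFord_concat (E : List Edge) (s : ℕ) (fuel : List ℕ) (i : ℕ) :
    bellmanFord E s (fuel ++ [i]) = relax E s (bellmanFord E s fuel) := by
  simp [bellmanFord]

/-- `Reach E s v w τ k`: there is a walk from `s` to `v` of length `w` with `k` arcs, with tags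
`τ` in reversed order. -/
inductive Reach (E : List Edge) (s : ℕ) : ℕ → ℚ → List ℕ → ℕ → Prop
  | nil : Reach E s s 0 [] 0
  | snoc {e : Edge} {w : ℚ} {τ : List ℕ} {k : ℕ} : e ∈ E → Reach E s e.tail w τ k →
      Reach E s e.head (w + e.weight.val) (e.tag :: τ) (k + 1)

theorem Reach.trans {E : List Edge} {s u v : ℕ} {w w' : ℚ} {τ τ' : List ℕ} {k k' : ℕ}
    (h : Reach E s u w τ k) (h' : Reach E u v w' τ' k') :
    Reach E s v (w + w') (τ' ++ τ) (k + k') := by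
  induction h' with
  | nil => simpa using h
  | snoc he _ ih =>
    rw [← add_assoc]
    exact .snoc he ih

theorem Reach.single {E : List Edge} {e : Edge} (he : e ∈ E) :
    Reach E e.tail e.head e.weight.val [e.tag] 1 := by
  simpa using Reach.snoc he .nil

theorem reach_of_mem_bellmanFord {E : List Edge} {s : ℕ} {fuel : List ℕ} :
    ∀ {l : Label}, l ∈ bellmanFord E s fuel → ∃ k, Reach E s l.node l.dist.val l.tags k := by
  induction fuel using List.reverseRecOn with
  | nil =>
    intro l hl
    obtain rfl : l = ⟨s, 0, []⟩ := by simpa [bellmanFord] using hl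
    exact ⟨0, by simpa using Reach.nil⟩
  | append_singleton fuel i ih =>
    intro l hl
    rw [bellmanFord_concat, mem_relax] at hl
    rcases hl with rfl | ⟨e, he, b, hb, rfl⟩
    · exact ⟨0, by simpa using Reach.nil⟩
    · obtain ⟨hb, hbe⟩ := mem_of_bestAt hb
      obtain ⟨k, hk⟩ := ih hb
      rw [hbe] at hk
      exact ⟨k + 1, by simpa using Reach.snoc he hk⟩

theorem exists_mem_bellmanFord {E : List Edge} {s : ℕ} {fuel : List ℕ} :
    ∀ {v : ℕ} {w : ℚ} {τ : List ℕ} {k : ℕ}, Reach E s v w τ k → k ≤ fuel.length →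
      ∃ l ∈ bellmanFord E s fuel, l.node = v ∧ l.dist.val ≤ w := by
  induction fuel using List.reverseRecOn with
  | nil =>
    intro v w τ k h hk
    cases h with
    | nil => exact ⟨⟨s, 0, []⟩, by simp [bellmanFord], rfl, by simp⟩
    | snoc => simp at hk
  | append_singleton fuel i ih =>
    intro v w τ k h hk
    rw [bellmanFord_concat]
    cases h with
    | nil => exact ⟨⟨s, 0, []⟩, mem_relax.2 (.inl rfl), rfl, by simp⟩
    | @snoc e w τ k he h =>
      obtain ⟨l, hl, hle, hlw⟩ := ih h (by simpa using hk)
      obtain ⟨b, hb, hbl⟩ := exists_bestAt_le hl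
      rw [hle] at hb
      refine ⟨_, mem_relax.2 (.inr ⟨e, he, b, hb, rfl⟩), rfl, ?_⟩
      simp only [Frac.val_add]
      linarith

/-- The algorithm of Bellman and Ford finds shortest walks among those with a bounded number of
arcs. -/
theorem exists_bestAt_bellmanFord {E : List Edge} {s v : ℕ} {fuel : List ℕ} {w : ℚ} {τ : List ℕ}
    {k : ℕ} (h : Reach E s v w τ k) (hk : k ≤ fuel.length) :
    ∃ b, bestAt v (bellmanFord E s fuel) = some b ∧ b.dist.val ≤ w := by
  obtain ⟨l, hl, rfl, hw⟩ := exists_mem_bellmanFord h hk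
  obtain ⟨b, hb, hbl⟩ := exists_bestAt_le hl
  exact ⟨b, hb, hbl.trans hw⟩

theorem reach_of_bestAt_bellmanFord {E : List Edge} {s v : ℕ} {fuel : List ℕ} {b : Label}
    (h : bestAt v (bellmanFord E s fuel) = some b) : ∃ k, Reach E s v b.dist.val b.tags k := by
  obtain ⟨hb, rfl⟩ := mem_of_bestAt h
  exact reach_of_mem_bellmanFord hb

/-! ### Running time of the shortest walk algorithm -/

theorem esize_edge (e : Edge) :
    esize e = esize e.tail + (esize e.head + (esize e.weight + esize e.tag + 1) + 1) + 1 := rfl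

theorem esize_label (l : Label) :
    esize l = esize l.node + (esize l.dist + esize l.tags + 1) + 1 := rfl

/-- The labels of the `k`-th round have size `O(k)`. -/
theorem bellmanFord_bounds {E : List Edge} {s N : ℕ} (hN : esize E + esize s + 2 ≤ N)
    (fuel : List ℕ) : (bellmanFord E s fuel).length ≤ E.length + 1 ∧
      ∀ l ∈ bellmanFord E s fuel, esize l.node ≤ N ∧ l.dist.width ≤ (fuel.length + 1) * (N + 1) ∧
        esize l.tags ≤ (fuel.length + 1) * (N + 1) := by
  have h0 : (0 : Frac).width = 2 := by decide
  induction fuel using List.reverseRecOn with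
  | nil => simp [bellmanFord, h0]; omega
  | append_singleton fuel i ih =>
    rw [bellmanFord_concat]
    constructor
    · have := List.length_filterMap_le (fun e => (bestAt e.tail (bellmanFord E s fuel)).map
        fun l => (⟨e.head, l.dist + e.weight, e.tag :: l.tags⟩ : Label)) E
      simpa [relax] using this
    · intro l hl
      rw [mem_relax] at hl
      have h3 : N + 1 ≤ ((fuel ++ [i]).length + 1) * (N + 1) :=
        Nat.le_mul_of_pos_left _ (by simp)
      rcases hl with rfl | ⟨e, he, b, hb, rfl⟩
      · simp only [h0, esize_nil]
        omega
      · obtain ⟨h1, h2, h4⟩ := ih.2 b (mem_of_bestAt hb).1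
        have h5 := esize_le_of_mem he
        have h6 := esize_edge e
        have h7 := Frac.width_add_le b.dist e.weight
        have h8 := Frac.width_le_esize e.weight
        simp only [esize_cons, List.length_append, List.length_singleton, add_mul, one_mul] at *
        omega

namespace PTime

variable {α β γ : Type} [Enc α] [Enc β] [Enc γ]

theorem edgeToProd {f : α → Edge} (hf : PTime f) :
    PTime fun a => ((f a).tail, (f a).head, (f a).weight, (f a).tag) :=
  of_enc_eq hf (fun a => a) (fun _ => rfl) fun _ => rfl

theorem edgeMk {f : α → Edge} (h1 : PTime fun a => (f a).tail) (h2 : PTime fun a => (f a).head)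
    (h3 : PTime fun a => (f a).weight) (h4 : PTime fun a => (f a).tag) : PTime f :=
  of_enc_eq (h1.pair (h2.pair (h3.pair h4))) (fun a => a) (fun _ => rfl) fun _ => rfl

theorem labelToProd {f : α → Label} (hf : PTime f) :
    PTime fun a => ((f a).node, (f a).dist, (f a).tags) :=
  of_enc_eq hf (fun a => a) (fun _ => rfl) fun _ => rfl

theorem labelMk {f : α → Label} (h1 : PTime fun a => (f a).node) (h2 : PTime fun a => (f a).dist)
    (h3 : PTime fun a => (f a).tags) : PTime f :=
  of_enc_eq (h1.pair (h2.pair h3)) (fun a => a) (fun _ => rfl) fun _ => rfl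

theorem bestAt {v : γ → ℕ} {T : γ → List Label} (hv : PTime v) (hT : PTime T) :
    PTime fun c => _root_.bestAt (v c) (T c) := by
  refine foldl_of_growth (h := fun c acc l => if l.node = v c then
    acc.elim (Option.some l) fun b => if l.dist.Le b.dist then Option.some l else Option.some b
      else acc) hT (const none) ?_ ⟨Polynomial.X + 2, fun c s a => ?_⟩
  · have hl : PTime fun x : γ × Option Label × Label => x.2.2 := snd.comp snd
    have hacc : PTime fun x : γ × Option Label × Label => x.2.1 := fst.comp snd
    have hd : PTime fun l : Label => l.dist := fst.comp (snd.comp id.labelToProd)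
    exact ite (natEq (fst.comp hl.labelToProd) (hv.comp fst))
      (optionElim (o := fun x : γ × Option Label × Label => x.2.1)
        (g := fun x => Option.some x.2.2)
        (h := fun x b => if x.2.2.dist.Le b.dist then Option.some x.2.2 else Option.some b)
        hacc hl.some (ite (fracLe (hd.comp (hl.comp fst)) (hd.comp snd)) (hl.comp fst).some
          snd.some)) hacc
  · simp only [Polynomial.eval_add, Polynomial.eval_X, Polynomial.eval_ofNat]
    split_ifs
    · cases s with
      | none => simp; omega
      | some b =>
        simp only [Option.elim_some]
        split_ifs <;> simp; omega
    · omega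

theorem relax {E : γ → List Edge} {s : γ → ℕ} {T : γ → List Label} (hE : PTime E) (hs : PTime s)
    (hT : PTime T) : PTime fun c => _root_.relax (E c) (s c) (T c) := by
  have he : PTime fun x : (γ × Edge) × Label =>
    (x.1.2.tail, x.1.2.head, x.1.2.weight, x.1.2.tag) := (snd.comp fst).edgeToProd
  have hl : PTime fun x : (γ × Edge) × Label => (x.2.node, x.2.dist, x.2.tags) := snd.labelToProd
  refine cons (labelMk hs (const _) (const _)) (filterMap hE (optionMap
    (bestAt (fst.comp snd.edgeToProd) (hT.comp fst)) (labelMk (fst.comp (snd.comp he)) ?_ ?_)))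
  · exact fracAdd (fst.comp (snd.comp hl)) (fst.comp (snd.comp (snd.comp he)))
  · exact cons (snd.comp (snd.comp (snd.comp he))) (snd.comp (snd.comp hl))

theorem bellmanFord {E : γ → List Edge} {s : γ → ℕ} {fuel : γ → List ℕ} (hE : PTime E)
    (hs : PTime s) (hfuel : PTime fuel) :
    PTime fun c => _root_.bellmanFord (E c) (s c) (fuel c) := by
  have key : PTime fun c : (List Edge × ℕ) × List ℕ => _root_.bellmanFord c.1.1 c.1.2 c.2 := by
    have h1 : PTime fun x : (List Edge × ℕ) × List ℕ => x.1.1 := fst.comp fst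
    have h2 : PTime fun x : (List Edge × ℕ) × List ℕ => x.1.2 := snd.comp fst
    refine foldl (h := fun (x : (List Edge × ℕ) × List ℕ) T _ => _root_.relax x.1.1 x.1.2 T) snd
      ((labelMk h2 (const 0) (const [])).cons (const []))
      (relax (h1.comp fst) (h2.comp fst) (fst.comp snd))
      ⟨(Polynomial.X + 1) * ((Polynomial.X + 2) +
        3 * ((Polynomial.X + 1) * (Polynomial.X + 2 + 1)) + 3 + 1) + 1, ?_⟩
    rintro ⟨⟨E, s⟩, f⟩ l
    set M := esize ((E, s), f) + esize l with hM
    obtain ⟨hlen, hB⟩ := bellmanFord_bounds (E := E) (s := s) (N := M + 2)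
      (by simp only [esize_pair] at hM; omega) l
    have h1 := length_lt_esize E
    have h2 := length_lt_esize l
    have hM' : (l.length + 1) * (M + 2 + 1) ≤ (M + 1) * (M + 2 + 1) := by
      gcongr
      omega
    have h3 := esize_le_length_mul (l := _root_.bellmanFord E s l)
      (B := (M + 2) + 3 * ((M + 1) * (M + 2 + 1)) + 3) fun b hb => by
        obtain ⟨h4, h5, h6⟩ := hB b hb
        have h7 := Frac.esize_le_width b.dist
        rw [esize_label]
        omega
    refine h3.trans ?_
    simp only [Polynomial.eval_add, Polynomial.eval_mul, Polynomial.eval_X, Polynomial.eval_one,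
      Polynomial.eval_ofNat]
    refine Nat.add_le_add_right (Nat.mul_le_mul_right _ (hlen.trans ?_)) 1
    simp only [esize_pair] at hM
    omega
  exact key.comp ((hE.pair hs).pair hfuel)

end PTime

/-! ### The algorithm -/

/-- An arc of the input, with its first-stage cost and its second-stage costs. -/
structure InputArc where
  tail : ℕ
  head : ℕ
  first : Frac
  second : List Frac

/-- The data of an instance, with fractions in place of rational numbers, and without the
correspondence between arcs and elements of a finite type. -/
structure Input where
  n : ℕ
  s : ℕ
  t : ℕ
  arcs : List InputArc
  probs : List Frac

instance : Enc InputArc := ⟨fun a => enc ((a.tail, a.head), (a.first, a.second))⟩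
instance : Enc Input := ⟨fun I => enc (I.n, (I.s, I.t), (I.arcs, I.probs))⟩

/-- The entry of a list at an index, or `0`, in terms of a fold. -/
def nth (l : List Frac) (j : ℕ) : Frac :=
  l.zipIdx.foldl (fun r x => if x.2 = j then x.1 else r) 0

/-- The least expected second-stage cost of getting from `u` to `v`, if each scenario may choose its
own walk; the arc lists in `scen` have the cost of an arc in the scenario times the probability as
weights. -/
def jump (scen : List (List Edge)) (fuel : List ℕ) (u v : ℕ) : Option Frac :=
  scen.foldl (fun acc E => acc.bind fun x =>
    (bestAt v (bellmanFord E u fuel)).map fun l => x + l.dist) (some 0)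

namespace Input

variable (I : Input)

/-- The source and the heads of the arcs. These are all nodes that walks from the source visit. -/
def nodes : List ℕ := I.s :: I.arcs.map InputArc.head

/-- A list whose length bounds the number of arcs of a walk in which first-stage arcs and jumps
alternate. -/
def fuel : List ℕ := I.nodes ++ I.nodes

/-- For each scenario, the arcs with their costs in the scenario times its probability. -/
def scenarios : List (List Edge) :=
  I.probs.zipIdx.map fun p => I.arcs.map fun a => ⟨a.tail, a.head, p.1 * nth a.second p.2, 0⟩

/-- The arcs with their first-stage costs, numbered from `1`. -/
def firstEdges : List Edge :=
  (I.arcs.zipIdx 1).map fun a => ⟨a.1.tail, a.1.head, a.1.first, a.2⟩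

/-- An arc for each jump, with tag `0`. Jumps from a node to itself are harmless. -/
def jumpEdges : List Edge :=
  I.nodes.flatMap fun u => I.nodes.filterMap fun v =>
    (jump I.scenarios I.fuel u v).map fun w => ⟨u, v, w, 0⟩

/-- A shortest walk that consists of first-stage arcs and jumps. -/
def best : Option Label := bestAt I.t (bellmanFord (I.firstEdges ++ I.jumpEdges) I.s I.fuel)

/-- The characteristic vector of a first-stage solution, and its value. -/
def solve : List ℕ × ℤ × ℤ :=
  I.best.elim ([], 0, 1) fun b =>
    ((I.arcs.zipIdx 1).map fun a => if a.2 ∈ b.tags then 1 else 0, b.dist.num, b.dist.den)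

end Input

/-! ### Running time of the algorithm -/

namespace PTime

variable {α β γ : Type} [Enc α] [Enc β] [Enc γ]

theorem nth {l : γ → List Frac} {j : γ → ℕ} (hl : PTime l) (hj : PTime j) :
    PTime fun c => _root_.nth (l c) (j c) := by
  refine foldl_of_growth (h := fun c (r : Frac) x => if x.2 = j c then x.1 else r) hl.zipIdx
    (const 0) ?_ ⟨Polynomial.X, fun c s a => ?_⟩
  · exact ite (natEq (snd.comp (snd.comp snd)) (hj.comp fst)) (fst.comp (snd.comp snd))
      (fst.comp snd)
  · obtain ⟨a, i⟩ := a
    split_ifs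
    · simp; omega
    · simp

theorem mem {l : γ → List ℕ} {i : γ → ℕ} (hl : PTime l) (hi : PTime i) :
    PTime fun c => decide (i c ∈ l c) := by
  refine of_enc_eq (foldl_of_growth (h := fun c (r : Bool) x => if x = i c then true else r) hl
    (const false) ?_ ⟨2, fun c s a => ?_⟩) (fun c => c) (fun _ => rfl) fun c => ?_
  · exact ite (natEq (snd.comp snd) (hi.comp fst)) (const true) (fst.comp snd)
  · have := esize_bool true
    split_ifs <;> simp; omega
  · congr 1
    induction l c using List.reverseRecOn with
    | nil => simp
    | append_singleton l x ih =>
      rw [List.foldl_append, ih]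
      by_cases h : x = i c <;> simp [h, eq_comm]

theorem jump {scen : γ → List (List Edge)} {fuel : γ → List ℕ} {u v : γ → ℕ} (hscen : PTime scen)
    (hfuel : PTime fuel) (hu : PTime u) (hv : PTime v) :
    PTime fun c => _root_.jump (scen c) (fuel c) (u c) (v c) := by
  have hb : PTime fun x : γ × List Edge =>
      (_root_.bestAt (v x.1) (_root_.bellmanFord x.2 (u x.1) (fuel x.1))) :=
    bestAt (hv.comp fst) (bellmanFord snd (hu.comp fst) (hfuel.comp fst))
  obtain ⟨q, hq⟩ := hb.size_le
  refine foldl_of_measure (fun o => o.elim 0 Frac.width) (h := fun c acc E => acc.bind fun x =>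
      (_root_.bestAt (v c) (_root_.bellmanFord E (u c) (fuel c))).map fun l => x + l.dist)
    hscen (const (Option.some 0)) ?_ ⟨2 * Polynomial.X + 3, ?_⟩
    ⟨Polynomial.C (Frac.width 0), fun c => by simp⟩ ⟨q.comp (Polynomial.X + 1) + 1, ?_⟩
  · refine optionBind (h := fun (y : γ × Option Frac × List Edge) x =>
      (_root_.bestAt (v y.1) (_root_.bellmanFord y.2.2 (u y.1) (fuel y.1))).map fun l => x + l.dist)
      (fst.comp snd) (optionMap (hb.comp ((fst.comp fst).pair (snd.comp (snd.comp fst)))) ?_)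
    exact fracAdd (snd.comp fst) (fst.comp (snd.comp snd.labelToProd))
  · rintro (_ | x)
    · simp
    · have := Frac.esize_le_width x
      simp; omega
  · intro c s E
    cases s with
    | none => simp
    | some x =>
      simp only [Option.bind_some, Option.elim_some]
      have := hq (c, E)
      cases h : _root_.bestAt (v c) (_root_.bellmanFord E (u c) (fuel c)) with
      | none => simp
      | some l =>
        rw [h] at this
        have h1 := Frac.width_add_le x l.dist
        have h2 := Frac.width_le_esize l.dist
        have h3 := esize_label l
        simp at this ⊢
        omega

theorem inputArcToProd {f : α → InputArc} (hf : PTime f) :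
    PTime fun a => (((f a).tail, (f a).head), ((f a).first, (f a).second)) :=
  of_enc_eq hf (fun a => a) (fun _ => rfl) fun _ => rfl

/-- The algorithm is polynomial on all inputs, whether or not the network is acyclic. -/
theorem solve : PTime Input.solve := by
  have hI : PTime fun I : Input => (I.n, (I.s, I.t), (I.arcs, I.probs)) :=
    of_enc_eq (id (α := Input)) (fun a => a) (fun _ => rfl) fun _ => rfl
  have hs : PTime Input.s := fst.comp (fst.comp (snd.comp hI))
  have ht : PTime Input.t := snd.comp (fst.comp (snd.comp hI))
  have harcs : PTime Input.arcs := fst.comp (snd.comp (snd.comp hI))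
  have hprobs : PTime Input.probs := snd.comp (snd.comp (snd.comp hI))
  have htail : PTime InputArc.tail := fst.comp (fst.comp id.inputArcToProd)
  have hhead : PTime InputArc.head := snd.comp (fst.comp id.inputArcToProd)
  have hfirst : PTime InputArc.first := fst.comp (snd.comp id.inputArcToProd)
  have hsecond : PTime InputArc.second := snd.comp (snd.comp id.inputArcToProd)
  have hnodes : PTime Input.nodes :=
    hs.cons (map (h := fun _ => InputArc.head) harcs (hhead.comp snd))
  have hfuel : PTime Input.fuel := hnodes.append hnodes
  have hscen : PTime Input.scenarios := by
    refine map (h := fun I p => I.arcs.map fun a => (⟨a.tail, a.head, p.1 * _root_.nth a.second p.2,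
      0⟩ : Edge)) hprobs.zipIdx (map (harcs.comp fst) (edgeMk (htail.comp snd) (hhead.comp snd)
        (fracMul ?_ (nth (hsecond.comp snd) ?_)) (const 0)))
    · exact fst.comp (snd.comp fst)
    · exact snd.comp (snd.comp fst)
  have hfirstE : PTime Input.firstEdges :=
    map (h := fun _ (a : InputArc × ℕ) => (⟨a.1.tail, a.1.head, a.1.first, a.2⟩ : Edge))
      (harcs.zipIdx (i := 1))
      (edgeMk (htail.comp (fst.comp snd)) (hhead.comp (fst.comp snd)) (hfirst.comp (fst.comp snd))
        (snd.comp snd))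
  have hjumpE : PTime Input.jumpEdges := by
    refine flatMap (h := fun I u => I.nodes.filterMap fun v =>
      (_root_.jump I.scenarios I.fuel u v).map fun w => (⟨u, v, w, 0⟩ : Edge)) hnodes
      (filterMap (h := fun (x : Input × ℕ) v => (_root_.jump x.1.scenarios x.1.fuel x.2 v).map
        fun w => (⟨x.2, v, w, 0⟩ : Edge)) (hnodes.comp fst) (optionMap (h := fun
          (x : (Input × ℕ) × ℕ) w => (⟨x.1.2, x.2, w, 0⟩ : Edge)) (jump ?_ ?_ ?_ ?_)
          (edgeMk ?_ ?_ snd (const 0))))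
    · exact hscen.comp (fst.comp fst)
    · exact hfuel.comp (fst.comp fst)
    · exact snd.comp fst
    · exact snd
    · exact snd.comp (fst.comp fst)
    · exact snd.comp fst
  have hbest : PTime Input.best := bestAt ht (bellmanFord (hfirstE.append hjumpE) hs hfuel)
  refine optionElim (h := fun (I : Input) (b : Label) => ((I.arcs.zipIdx 1).map fun a =>
    if a.2 ∈ b.tags then 1 else 0, b.dist.num, b.dist.den)) hbest (const _) (pair (map
      (h := fun (x : Input × Label) a => if a.2 ∈ x.2.tags then 1 else 0)
      (harcs.comp fst).zipIdx (ite (mem ?_ ?_) (const 1) (const 0))) ?_)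
  · exact snd.comp (snd.comp (snd.comp fst).labelToProd)
  · exact snd.comp snd
  · have : PTime fun x : Input × Label => x.2.dist := fst.comp (snd.comp snd.labelToProd)
    exact this.fracNum.pair this.fracDen

end PTime

/-! ### Series-parallel networks are acyclic -/

namespace Network

variable {G : Network}

theorem isWalk_append {l l' : List (Fin G.m)} {u w : Fin G.n} :
    G.IsWalk u (l ++ l') w ↔ ∃ v, G.IsWalk u l v ∧ G.IsWalk v l' w := by
  induction l generalizing u with
  | nil => simp [IsWalk]
  | cons a l ih => simp [IsWalk, ih, and_assoc]

theorem IsWalk.eq_or_exists_head {l : List (Fin G.m)} {u v : Fin G.n} (h : G.IsWalk u l v) :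
    v = u ∨ ∃ a, G.head a = v := by
  induction l generalizing u with
  | nil => exact .inl (Eq.symm h)
  | cons a l ih =>
    rcases ih h.2 with rfl | h'
    · exact .inr ⟨a, rfl⟩
    · exact .inr h'

theorem IsSP.mem {W : Finset (Fin G.n)} {B : Finset (Fin G.m)} {u v : Fin G.n}
    (h : G.IsSP W B u v) : u ∈ W ∧ v ∈ W ∧ ∀ a ∈ B, G.tail a ∈ W ∧ G.head a ∈ W := by
  induction h with
  | arc a => simp
  | series _ _ _ _ ih₁ ih₂ | parallel _ _ _ _ ih₁ ih₂ =>
    simp only [Finset.mem_union]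
    refine ⟨.inl ih₁.1, .inr ih₂.2.1, ?_⟩
    rintro a (ha | ha)
    · exact ⟨.inl (ih₁.2.2 a ha).1, .inl (ih₁.2.2 a ha).2⟩
    · exact ⟨.inr (ih₂.2.2 a ha).1, .inr (ih₂.2.2 a ha).2⟩

theorem IsSP.exists_isWalk {W : Finset (Fin G.n)} {B : Finset (Fin G.m)} {u v : Fin G.n}
    (h : G.IsSP W B u v) : ∃ l, G.IsWalk u l v := by
  induction h with
  | arc a => exact ⟨[a], rfl, rfl⟩
  | series _ _ _ _ ih₁ ih₂ =>
    obtain ⟨l₁, h₁⟩ := ih₁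
    obtain ⟨l₂, h₂⟩ := ih₂
    exact ⟨l₁ ++ l₂, isWalk_append.2 ⟨_, h₁, h₂⟩⟩
  | parallel _ _ _ _ ih₁ => exact ih₁

/-- A potential that increases along all arcs. Normalizing it to `0` at the source and to `1` at
the sink makes the potentials of two components fit together. -/
theorem IsSP.exists_rank {W : Finset (Fin G.n)} {B : Finset (Fin G.m)} {u v : Fin G.n}
    (h : G.IsSP W B u v) :
    ∃ r : Fin G.n → ℚ, r u = 0 ∧ r v = 1 ∧ ∀ a ∈ B, r (G.tail a) < r (G.head a) := by
  induction h with
  | arc a ha =>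
    exact ⟨fun z => if z = G.tail a then 0 else 1, by simp, by simp [ha.symm], by simp [ha.symm]⟩
  | @series W₁ W₂ B₁ B₂ u v w h₁ h₂ hW _ ih₁ ih₂ =>
    obtain ⟨r₁, hu₁, hw₁, hr₁⟩ := ih₁
    obtain ⟨r₂, hw₂, hv₂, hr₂⟩ := ih₂
    have e₁ (z) (hz : z ∈ W₁) : (if z ∈ W₁ then r₁ z / 2 else (1 + r₂ z) / 2) = r₁ z / 2 :=
      if_pos hz
    have e₂ (z) (hz : z ∈ W₂) :
        (if z ∈ W₁ then r₁ z / 2 else (1 + r₂ z) / 2) = (1 + r₂ z) / 2 := by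
      split_ifs with hz₁
      · obtain rfl : z = w := by
          have : z ∈ W₁ ∩ W₂ := Finset.mem_inter.2 ⟨hz₁, hz⟩
          simpa [hW] using this
        simp [hw₁, hw₂]
      · rfl
    refine ⟨fun z => if z ∈ W₁ then r₁ z / 2 else (1 + r₂ z) / 2, ?_, ?_, fun a ha => ?_⟩
    · exact (e₁ _ h₁.mem.1).trans (by rw [hu₁]; norm_num)
    · exact (e₂ _ h₂.mem.2.1).trans (by rw [hv₂]; norm_num)
    · rcases Finset.mem_union.1 ha with ha | ha
      · simp only [e₁ _ (h₁.mem.2.2 a ha).1, e₁ _ (h₁.mem.2.2 a ha).2]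
        linarith [hr₁ a ha]
      · simp only [e₂ _ (h₂.mem.2.2 a ha).1, e₂ _ (h₂.mem.2.2 a ha).2]
        linarith [hr₂ a ha]
  | @parallel W₁ W₂ B₁ B₂ u v h₁ h₂ hW _ ih₁ ih₂ =>
    obtain ⟨r₁, hu₁, hv₁, hr₁⟩ := ih₁
    obtain ⟨r₂, hu₂, hv₂, hr₂⟩ := ih₂
    have e₁ (z) (hz : z ∈ W₁) : (if z ∈ W₁ then r₁ z else r₂ z) = r₁ z := if_pos hz
    have e₂ (z) (hz : z ∈ W₂) : (if z ∈ W₁ then r₁ z else r₂ z) = r₂ z := by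
      split_ifs with hz₁
      · have : z ∈ W₁ ∩ W₂ := Finset.mem_inter.2 ⟨hz₁, hz⟩
        rw [hW, Finset.mem_insert, Finset.mem_singleton] at this
        rcases this with rfl | rfl
        · rw [hu₁, hu₂]
        · rw [hv₁, hv₂]
      · rfl
    refine ⟨fun z => if z ∈ W₁ then r₁ z else r₂ z, ?_, ?_, fun a ha => ?_⟩
    · exact (e₁ _ h₁.mem.1).trans hu₁
    · exact (e₁ _ h₁.mem.2.1).trans hv₁
    · rcases Finset.mem_union.1 ha with ha | ha
      · simp only [e₁ _ (h₁.mem.2.2 a ha).1, e₁ _ (h₁.mem.2.2 a ha).2]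
        exact hr₁ a ha
      · simp only [e₂ _ (h₂.mem.2.2 a ha).1, e₂ _ (h₂.mem.2.2 a ha).2]
        exact hr₂ a ha

section Acyclic

variable {r : Fin G.n → ℚ}

theorem IsWalk.rank_le (hr : ∀ a, r (G.tail a) < r (G.head a)) {l : List (Fin G.m)}
    {u v : Fin G.n} (h : G.IsWalk u l v) :
    r u ≤ r v ∧ ∀ a ∈ l, r u ≤ r (G.tail a) ∧ r (G.head a) ≤ r v := by
  induction l generalizing u with
  | nil => obtain rfl : u = v := h; simp
  | cons a l ih =>
    obtain ⟨rfl, h⟩ := h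
    obtain ⟨h1, h2⟩ := ih h
    have ha := hr a
    refine ⟨ha.le.trans h1, fun b hb => ?_⟩
    rcases List.mem_cons.1 hb with rfl | hb
    · exact ⟨le_rfl, h1⟩
    · exact ⟨ha.le.trans (h2 b hb).1, (h2 b hb).2⟩

theorem IsWalk.pairwise (hr : ∀ a, r (G.tail a) < r (G.head a)) {l : List (Fin G.m)}
    {u v : Fin G.n} (h : G.IsWalk u l v) : l.Pairwise fun a b => r (G.head a) < r (G.head b) := by
  induction l generalizing u with
  | nil => simp
  | cons a l ih =>
    refine List.pairwise_cons.2 ⟨fun b hb => ?_, ih h.2⟩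
    exact ((h.2.rank_le hr).2 b hb).1.trans_lt (hr b)

theorem IsWalk.nodup (hr : ∀ a, r (G.tail a) < r (G.head a)) {l : List (Fin G.m)}
    {u v : Fin G.n} (h : G.IsWalk u l v) : l.Nodup :=
  (h.pairwise hr).imp fun hab => by rintro rfl; exact lt_irrefl _ hab

/-- In an acyclic network all walks are simple paths. -/
theorem mem_feasible (hr : ∀ a, r (G.tail a) < r (G.head a)) {P : Finset (Fin G.m)} :
    P ∈ G.feasible ↔ ∃ l, G.IsWalk G.s l G.t ∧ l.toFinset = P := by
  refine ⟨fun ⟨l, h, hP⟩ => ⟨l, h.1, hP⟩, fun ⟨l, h, hP⟩ => ⟨l, ⟨h, ?_⟩, hP⟩⟩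
  refine List.nodup_cons.2 ⟨fun hs => ?_, ?_⟩
  · obtain ⟨a, ha, has⟩ := List.mem_map.1 hs
    have := ((h.rank_le hr).2 a ha).1.trans_lt (hr a)
    rw [has] at this
    exact lt_irrefl _ this
  · refine List.pairwise_map.2 ((h.pairwise hr).imp fun hab e => ?_)
    rw [e] at hab
    exact lt_irrefl _ hab

end Acyclic

end Network

/-! ### The input of the algorithm -/

theorem nth_eq_getD (l : List Frac) (j : ℕ) : nth l j = l.getD j 0 := by
  induction l using List.reverseRecOn with
  | nil => simp [nth]
  | append_singleton l x ih =>
    have : nth (l ++ [x]) j = if l.length = j then x else nth l j := by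
      simp [nth, List.zipIdx_append]
    rw [this, ih]
    rcases lt_trichotomy l.length j with h | rfl | h
    · rw [if_neg h.ne]
      simp [List.getD, List.getElem?_append, h.not_gt, show j - l.length ≠ 0 by omega]
    · simp
    · rw [if_neg h.ne']
      simp [List.getD, List.getElem?_append, h]

theorem zipIdx_ofFn {α : Type} {m : ℕ} (f : Fin m → α) (k : ℕ) :
    (List.ofFn f).zipIdx k = List.ofFn fun i => (f i, k + i) := by
  apply List.ext_getElem <;> simp

namespace TwoStageInstance

variable (I : TwoStageInstance)

/-- An instance as an input of the algorithm. -/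
def toInput : Input where
  n := I.n
  s := I.s
  t := I.t
  arcs := List.ofFn fun a =>
    ⟨I.tail a, I.head a, .ofRat (I.C a), List.ofFn fun j => .ofRat (I.c j a)⟩
  probs := List.ofFn fun j => .ofRat (I.p j)

theorem enc_toInput : enc I.toInput = I.encode := by
  simp only [enc, encode, toInput, List.map_ofFn, Function.comp_def]
  rfl

/-- The arcs of the network with given weights and tags. -/
def edges (ω : Fin I.m → Frac) (τ : Fin I.m → ℕ) : List Edge :=
  List.ofFn fun a => ⟨I.tail a, I.head a, ω a, τ a⟩

/-- The arcs with their costs in a scenario times its probability. -/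
def scenarioEdges (j : Fin I.K) : List Edge :=
  I.edges (fun a => .ofRat (I.p j) * .ofRat (I.c j a)) fun _ => 0

theorem scenarios_toInput : I.toInput.scenarios = List.ofFn I.scenarioEdges := by
  simp only [Input.scenarios, toInput, zipIdx_ofFn, List.map_ofFn]
  congr 1
  ext1 j
  simp only [Function.comp_def, scenarioEdges, edges, nth_eq_getD]
  simp [List.getD]

theorem firstEdges_toInput :
    I.toInput.firstEdges = I.edges (fun a => .ofRat (I.C a)) fun a => 1 + a := by
  simp only [Input.firstEdges, toInput, zipIdx_ofFn, List.map_ofFn]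
  rfl

theorem mem_nodes_toInput {z : ℕ} :
    z ∈ I.toInput.nodes ↔ z = I.s ∨ ∃ a, ((I.head a : Fin I.n) : ℕ) = z := by
  simp [Input.nodes, toInput, List.map_ofFn, List.mem_ofFn]

theorem length_fuel_toInput : I.toInput.fuel.length = 2 * (I.m + 1) := by
  simp [Input.fuel, Input.nodes, toInput]; omega

variable {I}

theorem mem_edges {ω : Fin I.m → Frac} {τ : Fin I.m → ℕ} {e : Edge} :
    e ∈ I.edges ω τ ↔ ∃ a, e = ⟨I.tail a, I.head a, ω a, τ a⟩ := by
  simp [edges, List.mem_ofFn, eq_comm]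

theorem reach_edges_of_isWalk {ω : Fin I.m → Frac} {τ : Fin I.m → ℕ} {l : List (Fin I.m)} :
    ∀ {u v : Fin I.n}, I.IsWalk u l v →
      ∃ σ, Reach (I.edges ω τ) u v (l.map fun a => (ω a).val).sum σ l.length := by
  induction l with
  | nil =>
    intro u v h
    obtain rfl : u = v := h
    exact ⟨[], .nil⟩
  | cons a l ih =>
    rintro _ v ⟨rfl, h⟩
    obtain ⟨σ, hσ⟩ := ih h
    have := (Reach.single (mem_edges.2 ⟨a, rfl⟩)).trans hσ
    rw [add_comm 1] at this
    exact ⟨_, by simpa using this⟩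

theorem exists_isWalk_of_reach_edges {ω : Fin I.m → Frac} {τ : Fin I.m → ℕ} {u : Fin I.n} {z : ℕ}
    {w : ℚ} {σ : List ℕ} {k : ℕ} (h : Reach (I.edges ω τ) u z w σ k) :
    ∃ (v : Fin I.n) (l : List (Fin I.m)), z = v ∧ I.IsWalk u l v ∧
      w = (l.map fun a => (ω a).val).sum := by
  induction h with
  | nil => exact ⟨u, [], rfl, rfl, by simp⟩
  | snoc he _ ih =>
    obtain ⟨a, rfl⟩ := mem_edges.1 he
    obtain ⟨v, l, hv, hl, rfl⟩ := ih
    obtain rfl : I.tail a = v := Fin.ext hv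
    exact ⟨I.head a, l ++ [a], rfl, Network.isWalk_append.2 ⟨_, hl, rfl, rfl⟩, by simp⟩

end TwoStageInstance

/-! ### Jumps -/

theorem jump_concat (scen : List (List Edge)) (E : List Edge) (fuel : List ℕ) (u v : ℕ) :
    jump (scen ++ [E]) fuel u v = (jump scen fuel u v).bind fun x =>
      (bestAt v (bellmanFord E u fuel)).map fun l => x + l.dist := by
  simp [jump]

theorem exists_reach_of_jump {K : Type} {S : K → List Edge} {fuel : List ℕ} {u v : ℕ} {js : List K}
    {x : Frac} (h : jump (js.map S) fuel u v = some x) :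
      ∃ w : K → ℚ, (∀ j ∈ js, ∃ τ k, Reach (S j) u v (w j) τ k) ∧ x.val = (js.map w).sum := by
  -- The witness is the computed distance; the default `0` is never used for `j ∈ js`.
  refine ⟨fun j => (bestAt v (bellmanFord (S j) u fuel)).elim 0 fun l => l.dist.val, ?_⟩
  induction js using List.reverseRecOn generalizing x with
  | nil =>
    obtain rfl : 0 = x := by simpa [jump] using h
    simp
  | append_singleton js j ih =>
    rw [List.map_append, List.map_singleton, jump_concat] at h
    obtain ⟨y, hy, h⟩ := Option.bind_eq_some_iff.1 h
    obtain ⟨l, hl, rfl⟩ := Option.map_eq_some_iff.1 h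
    obtain ⟨h1, h2⟩ := ih hy
    refine ⟨fun i hi => ?_, by simp [h2, hl]⟩
    rcases List.mem_append.1 hi with hi | hi
    · exact h1 i hi
    · obtain rfl : i = j := by simpa using hi
      obtain ⟨k, hk⟩ := reach_of_bestAt_bellmanFord hl
      exact ⟨l.tags, k, by simpa [hl] using hk⟩

theorem exists_jump_of_reach {K : Type} {S : K → List Edge} {fuel : List ℕ} {u v : ℕ} {js : List K}
    {w : K → ℚ} (h : ∀ j ∈ js, ∃ τ k, Reach (S j) u v (w j) τ k ∧ k ≤ fuel.length) :
    ∃ x, jump (js.map S) fuel u v = some x ∧ x.val ≤ (js.map w).sum := by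
  induction js using List.reverseRecOn with
  | nil => exact ⟨0, by simp [jump]⟩
  | append_singleton js j ih =>
    obtain ⟨x, hx, hxw⟩ := ih fun i hi => h i (by simp [hi])
    obtain ⟨τ, k, hr, hk⟩ := h j (by simp)
    obtain ⟨b, hb, hbw⟩ := exists_bestAt_bellmanFord hr hk
    refine ⟨x + b.dist, by simp [jump_concat, hx, hb], ?_⟩
    simp
    linarith

namespace TwoStageInstance

variable {I : TwoStageInstance}

theorem mem_jumpEdges {J : Input} {e : Edge} : e ∈ J.jumpEdges ↔
    e.tail ∈ J.nodes ∧ e.head ∈ J.nodes ∧ e.tag = 0 ∧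
      jump J.scenarios J.fuel e.tail e.head = some e.weight := by
  simp only [Input.jumpEdges, List.mem_flatMap, List.mem_filterMap, Option.map_eq_some_iff]
  constructor
  · rintro ⟨u, hu, v, hv, w, hw, rfl⟩
    exact ⟨hu, hv, rfl, hw⟩
  · rintro ⟨hu, hv, h0, hw⟩
    exact ⟨_, hu, _, hv, _, hw, by rw [← h0]⟩

/-- A jump with the cost of an arbitrary choice of walks, or less. -/
theorem exists_jumpEdge {u v : Fin I.n} (hu : (u : ℕ) ∈ I.toInput.nodes)
    (hv : (v : ℕ) ∈ I.toInput.nodes) {l : Fin I.K → List (Fin I.m)}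
    (hl : ∀ j, I.IsWalk u (l j) v) (hm : ∀ j, (l j).length ≤ I.m) :
    ∃ x : Frac, (⟨u, v, x, 0⟩ : Edge) ∈ I.toInput.jumpEdges ∧
      x.val ≤ ∑ j, I.p j * ((l j).map (I.c j)).sum := by
  have key : ∀ j ∈ List.finRange I.K, ∃ τ k, Reach (I.scenarioEdges j) u v
      (I.p j * ((l j).map (I.c j)).sum) τ k ∧ k ≤ I.toInput.fuel.length := by
    intro j _
    obtain ⟨σ, hσ⟩ := reach_edges_of_isWalk
      (ω := fun a => .ofRat (I.p j) * .ofRat (I.c j a)) (τ := fun _ => 0) (hl j)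
    refine ⟨σ, _, ?_, (hm j).trans (by rw [length_fuel_toInput]; omega)⟩
    simpa [scenarioEdges, List.sum_map_mul_left] using hσ
  obtain ⟨x, hx, hxw⟩ := exists_jump_of_reach key
  refine ⟨x, mem_jumpEdges.2 ⟨hu, hv, rfl, ?_⟩, ?_⟩
  · rw [scenarios_toInput, List.ofFn_eq_map]
    exact hx
  · rwa [← List.ofFn_eq_map, List.sum_ofFn] at hxw

theorem exists_isWalk_of_mem_jumpEdges {e : Edge} (he : e ∈ I.toInput.jumpEdges) {u : Fin I.n}
    (hu : e.tail = u) : ∃ (v : Fin I.n) (l : Fin I.K → List (Fin I.m)), e.head = v ∧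
      (∀ j, I.IsWalk u (l j) v) ∧ e.weight.val = ∑ j, I.p j * ((l j).map (I.c j)).sum := by
  obtain ⟨-, hv, -, h⟩ := mem_jumpEdges.1 he
  rw [mem_nodes_toInput] at hv
  obtain ⟨v, hv⟩ : ∃ v : Fin I.n, e.head = v := by
    rcases hv with hv | ⟨a, ha⟩
    · exact ⟨I.s, hv⟩
    · exact ⟨I.head a, ha.symm⟩
  rw [scenarios_toInput, List.ofFn_eq_map] at h
  obtain ⟨w, hw, hx⟩ := exists_reach_of_jump h
  have (j : Fin I.K) : ∃ l, I.IsWalk u l v ∧ w j = I.p j * (l.map (I.c j)).sum := by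
    obtain ⟨τ, k, hk⟩ := hw j (List.mem_finRange j)
    rw [hu] at hk
    obtain ⟨v', l, hv', hl, hwj⟩ := exists_isWalk_of_reach_edges hk
    obtain rfl : v = v' := Fin.ext (hv.symm.trans hv')
    exact ⟨l, hl, by simpa [List.sum_map_mul_left] using hwj⟩
  choose l hl hwl using this
  refine ⟨v, l, hv, hl, ?_⟩
  rw [hx, ← List.ofFn_eq_map, List.sum_ofFn]
  exact Finset.sum_congr rfl fun j _ => hwl j

end TwoStageInstance

/-! ### Walks with jumps and first-stage solutions -/

namespace TwoStageInstance

variable {I : TwoStageInstance}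

/-- A walk with jumps gives, for every scenario, a walk through its first-stage arcs `X`, whose
other arcs `Y j` are the recourse action. -/
theorem exists_isWalk_of_reach {z : ℕ} {w : ℚ} {τ : List ℕ} {k : ℕ}
    (h : Reach (I.toInput.firstEdges ++ I.toInput.jumpEdges) I.s z w τ k) :
    ∃ (v : Fin I.n) (X : List (Fin I.m)) (Y l : Fin I.K → List (Fin I.m)), z = v ∧
      (∀ a : Fin I.m, 1 + (a : ℕ) ∈ τ ↔ a ∈ X) ∧ (∀ j, I.IsWalk I.s (l j) v) ∧
      (∀ j, (l j).Perm (X ++ Y j)) ∧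
      w = (X.map I.C).sum + ∑ j, I.p j * ((Y j).map (I.c j)).sum := by
  induction h with
  | nil =>
    exact ⟨I.s, [], fun _ => [], fun _ => [], rfl, by simp, fun _ => rfl, by simp, by simp⟩
  | snoc he _ ih =>
    obtain ⟨v, X, Y, l, hv, hX, hl, hp, rfl⟩ := ih
    rcases List.mem_append.1 he with he | he
    · rw [firstEdges_toInput] at he
      obtain ⟨a, rfl⟩ := mem_edges.1 he
      obtain rfl : I.tail a = v := Fin.ext hv
      refine ⟨I.head a, a :: X, Y, fun j => l j ++ [a], rfl, fun b => ?_, fun j => ?_, fun j => ?_,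
        ?_⟩
      · simp [hX, Fin.ext_iff]
      · exact Network.isWalk_append.2 ⟨_, hl j, rfl, rfl⟩
      · exact (List.perm_append_singleton a (l j)).trans ((hp j).cons a)
      · simp; ring
    · have h0 := (mem_jumpEdges.1 he).2.2.1
      obtain ⟨v', l', hv', hl', hw⟩ := exists_isWalk_of_mem_jumpEdges he hv
      refine ⟨v', X, fun j => Y j ++ l' j, fun j => l j ++ l' j, hv', fun b => ?_, fun j => ?_,
        fun j => ?_, ?_⟩
      · simp [hX, h0]
      · exact Network.isWalk_append.2 ⟨_, hl j, hl' j⟩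
      · rw [← List.append_assoc]
        exact (hp j).append_right _
      · simp only [hw, List.map_append, List.sum_append, mul_add, Finset.sum_add_distrib]
        ring

variable {r : Fin I.n → ℚ}

/-- A first-stage solution of a walk with jumps costs at most as much as the walk. -/
theorem firstStage_of_reach (hr : ∀ a, r (I.tail a) < r (I.head a)) {w : ℚ} {τ : List ℕ} {k : ℕ}
    (h : Reach (I.toInput.firstEdges ++ I.toInput.jumpEdges) I.s I.t w τ k) :
    ∃ x ∈ I.firstStage, (∀ a : Fin I.m, 1 + (a : ℕ) ∈ τ ↔ a ∈ x) ∧ I.expectedCost x ≤ w := by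
  classical
  obtain ⟨v, X, Y, l, hv, hX, hl, hp, rfl⟩ := exists_isWalk_of_reach h
  obtain rfl : I.t = v := Fin.ext hv
  have hnd (j) : (X ++ Y j).Nodup := (hp j).nodup_iff.1 ((hl j).nodup hr)
  have hy (j) : (Y j).toFinset ∈ I.recourse X.toFinset := by
    refine Finset.mem_filter.2 ⟨Finset.mem_univ _, ?_, ?_⟩
    · rw [List.disjoint_toFinset_iff_disjoint]
      exact List.disjoint_of_nodup_append (hnd j)
    · rw [← List.toFinset_append, ← List.toFinset_eq_of_perm _ _ (hp j)]
      exact (Network.mem_feasible hr).2 ⟨l j, hl j, rfl⟩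
  have hK : Nonempty (Fin I.K) := by
    by_contra hK
    rw [not_nonempty_iff] at hK
    simpa using I.p_sum
  refine ⟨X.toFinset, ⟨_, hy hK.some⟩, fun a => by simp [hX], ?_⟩
  have hcost (j) : I.cost X.toFinset j ≤ (X.map I.C).sum + ((Y j).map (I.c j)).sum := by
    unfold cost
    rw [dif_pos ⟨_, hy j⟩, List.sum_toFinset _ (hnd j).of_append_left]
    refine add_le_add_right ((Finset.inf'_le _ (hy j)).trans ?_) _
    rw [List.sum_toFinset _ (hnd j).of_append_right]
  calc I.expectedCost X.toFinset
      ≤ ∑ j, I.p j * ((X.map I.C).sum + ((Y j).map (I.c j)).sum) :=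
        Finset.sum_le_sum fun j _ => mul_le_mul_of_nonneg_left (hcost j) (I.p_pos j).le
    _ = _ := by
        simp only [mul_add, Finset.sum_add_distrib, ← Finset.sum_mul, I.p_sum, one_mul]

/-- In an acyclic network, all the walks through the arcs in `x` visit these arcs in the same
order. Hence a walk with jumps can follow them. -/
theorem exists_reach_of_isWalk (hr : ∀ a, r (I.tail a) < r (I.head a)) (hK : Nonempty (Fin I.K))
    {v : Fin I.n} (N : ℕ) : ∀ {x : Finset (Fin I.m)} {u : Fin I.n} {l : Fin I.K → List (Fin I.m)},
      x.card = N → (u : ℕ) ∈ I.toInput.nodes → (∀ j, I.IsWalk u (l j) v) →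
      (∀ j, ∀ a ∈ x, a ∈ l j) →
      ∃ w τ k, Reach (I.toInput.firstEdges ++ I.toInput.jumpEdges) u v w τ k ∧ k ≤ 2 * N + 1 ∧
        w ≤ ∑ a ∈ x, I.C a +
          ∑ j, I.p j * (((l j).filter (· ∉ x)).map (I.c j)).sum := by
  -- A walk starting at a node of the list ends at a node of the list, so that there is a jump.
  have hjump {u v : Fin I.n} {l : Fin I.K → List (Fin I.m)} (hu : (u : ℕ) ∈ I.toInput.nodes)
      (hl : ∀ j, I.IsWalk u (l j) v) : ∃ w, Reach (I.toInput.firstEdges ++ I.toInput.jumpEdges) u v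
        w [0] 1 ∧ w ≤ ∑ j, I.p j * ((l j).map (I.c j)).sum := by
    have hv : (v : ℕ) ∈ I.toInput.nodes := by
      rcases (hl hK.some).eq_or_exists_head with rfl | ⟨a, rfl⟩
      · exact hu
      · exact (mem_nodes_toInput I).2 (.inr ⟨a, rfl⟩)
    obtain ⟨y, hy, hyw⟩ := exists_jumpEdge hu hv hl fun j => by
      simpa using ((hl j).nodup hr).length_le_card
    exact ⟨_, Reach.single (List.mem_append_right _ hy), hyw⟩
  induction N with
  | zero =>
    intro x u l hx hu hl hxl
    obtain rfl := Finset.card_eq_zero.1 hx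
    obtain ⟨w, hw, hle⟩ := hjump hu hl
    exact ⟨w, _, _, hw, by omega, by simpa using hle⟩
  | succ N ih =>
    intro x u l hx hu hl hxl
    -- The arc of `x` that all the walks traverse first.
    obtain ⟨a, ha, hmin⟩ := x.exists_min_image (fun a => r (I.tail a))
      (Finset.card_pos.1 (by omega))
    have hsplit (j) : ∃ l₁ l₂, l j = l₁ ++ a :: l₂ := List.append_of_mem (hxl j a ha)
    choose l₁ l₂ hl₁₂ using hsplit
    have hw (j) : I.IsWalk u (l₁ j) (I.tail a) ∧ I.IsWalk (I.head a) (l₂ j) v := by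
      have := hl j
      rw [hl₁₂, Network.isWalk_append] at this
      obtain ⟨_, h1, rfl, h2⟩ := this
      exact ⟨h1, h2⟩
    have hnd (j) := (hl j).nodup hr
    -- No arc of `x` precedes `a`, so that the part before `a` belongs to the recourse action.
    have hl₁ (j) : ∀ b ∈ l₁ j, b ∉ x := fun b hb hbx =>
      absurd ((((hw j).1.rank_le hr).2 b hb).2) (not_le.2 ((hmin b hbx).trans_lt (hr b)))
    have hal₂ (j) : a ∉ l₂ j := fun hal => by
      have h := hnd j
      rw [hl₁₂] at h
      exact (List.nodup_cons.1 h.of_append_right).1 hal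
    obtain ⟨w₁, hw₁, hle₁⟩ := hjump hu fun j => (hw j).1
    have hfirst := Reach.single (List.mem_append_left I.toInput.jumpEdges
      (I.firstEdges_toInput ▸ mem_edges.2 ⟨a, rfl⟩))
    obtain ⟨w₂, τ, k, hw₂, hk, hle₂⟩ := ih (x := x.erase a) (u := I.head a) (l := l₂)
      (by rw [Finset.card_erase_of_mem ha]; omega)
      ((mem_nodes_toInput I).2 (.inr ⟨a, rfl⟩)) (fun j => (hw j).2) fun j b hb => by
        have hb' := hxl j b (Finset.mem_of_mem_erase hb)
        rw [hl₁₂, List.mem_append, List.mem_cons] at hb'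
        rcases hb' with hb' | rfl | hb'
        · exact absurd (Finset.mem_of_mem_erase hb) (hl₁ j b hb')
        · simp at hb
        · exact hb'
    refine ⟨_, _, _, (hw₁.trans hfirst).trans hw₂, by omega, ?_⟩
    have e (j) : (l j).filter (· ∉ x) = l₁ j ++ (l₂ j).filter (· ∉ x.erase a) := by
      rw [hl₁₂, List.filter_append, List.filter_cons_of_neg (by simpa using ha)]
      congr 1
      · exact List.filter_eq_self.2 fun b hb => by simpa using hl₁ j b hb
      · refine List.filter_congr fun b hb => ?_
        have : b ≠ a := by rintro rfl; exact hal₂ j hb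
        simp [this]
    simp only [e, List.map_append, List.sum_append, mul_add, Finset.sum_add_distrib]
    rw [← Finset.add_sum_erase _ _ ha]
    simp only [Frac.val_ofRat] at hle₂ ⊢
    linarith

theorem exists_reach_of_firstStage (hr : ∀ a, r (I.tail a) < r (I.head a))
    {x : Finset (Fin I.m)} (hx : x ∈ I.firstStage) :
    ∃ w τ k, Reach (I.toInput.firstEdges ++ I.toInput.jumpEdges) I.s I.t w τ k ∧
      k ≤ I.toInput.fuel.length ∧ w ≤ I.expectedCost x := by
  classical
  have hK : Nonempty (Fin I.K) := by
    by_contra hK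
    rw [not_nonempty_iff] at hK
    simpa using I.p_sum
  have hy (j) := Finset.exists_mem_eq_inf' hx fun y => ∑ a ∈ y, I.c j a
  choose y hy hcost using hy
  have hl (j) : ∃ l, I.IsWalk I.s l I.t ∧ l.toFinset = x ∪ y j :=
    (Network.mem_feasible hr).1 (Finset.mem_filter.1 (hy j)).2.2
  choose l hl hlx using hl
  obtain ⟨w, τ, k, hw, hk, hle⟩ := exists_reach_of_isWalk hr hK x.card rfl
    ((mem_nodes_toInput I).2 (.inl rfl)) hl fun j a ha => by
      rw [← List.mem_toFinset, hlx]
      exact Finset.mem_union_left _ ha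
  refine ⟨w, τ, k, hw, ?_, hle.trans_eq ?_⟩
  · have := x.card_le_univ
    rw [Fintype.card_fin] at this
    rw [length_fuel_toInput]
    omega
  · have e (j) : (((l j).filter (· ∉ x)).map (I.c j)).sum = ∑ a ∈ y j, I.c j a := by
      rw [← List.sum_toFinset _ (((hl j).nodup hr).filter _)]
      refine Finset.sum_congr ?_ fun _ _ => rfl
      have hd := (Finset.mem_filter.1 (hy j)).2.1
      ext a
      rw [List.toFinset_filter, hlx]
      have : a ∈ y j → a ∉ x := fun h => Finset.disjoint_right.1 hd h
      simp
      tauto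
    simp only [expectedCost, cost, dif_pos (show (I.recourse x).Nonempty from hx), hcost, e,
      mul_add, Finset.sum_add_distrib, ← Finset.sum_mul, I.p_sum, one_mul]

/-- The algorithm is correct on acyclic networks in which the sink can be reached. -/
theorem isSolution_solve (hr : ∀ a, r (I.tail a) < r (I.head a))
    (hst : ∃ l, I.IsWalk I.s l I.t) : I.IsSolution (enc I.toInput.solve) := by
  classical
  have hbest {x} (hx : x ∈ I.firstStage) : ∃ b, I.toInput.best = some b ∧
      b.dist.val ≤ I.expectedCost x := by
    obtain ⟨w, τ, k, hw, hk, hle⟩ := exists_reach_of_firstStage hr hx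
    obtain ⟨b, hb, hbw⟩ := exists_bestAt_bellmanFord hw hk
    exact ⟨b, hb, hbw.trans hle⟩
  obtain ⟨l, hl⟩ := hst
  have h0 : l.toFinset ∈ I.firstStage := ⟨∅, Finset.mem_filter.2 ⟨Finset.mem_univ _, by simp,
    (Network.mem_feasible hr).2 ⟨l, hl, by simp⟩⟩⟩
  obtain ⟨b, hb, -⟩ := hbest h0
  obtain ⟨k, hk⟩ := reach_of_bestAt_bellmanFord hb
  obtain ⟨x, hx, hxb, hle⟩ := firstStage_of_reach hr hk
  have hmin {x'} (hx' : x' ∈ I.firstStage) : b.dist.val ≤ I.expectedCost x' := by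
    obtain ⟨b', hb', hle'⟩ := hbest hx'
    obtain rfl : b = b' := Option.some.inj (hb.symm.trans hb')
    exact hle'
  refine ⟨x, b.dist.num, b.dist.den, ⟨hx, fun x' hx' => hle.trans (hmin hx')⟩,
    b.dist.den_pos.ne', le_antisymm hle (hmin hx), ?_⟩
  rw [Input.solve, hb]
  simp only [Option.elim_some, enc, toInput, zipIdx_ofFn, List.map_ofFn, Function.comp_def, hxb]
  simp only [Nat.cast_ite, Nat.cast_one, Nat.cast_zero]

end TwoStageInstance

theorem mainTheorem5 :
    PolynomiallySolvable TwoStageInstance.encode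
      {I : TwoStageInstance | I.toNetwork.SeriesParallel} TwoStageInstance.IsSolution := by
  obtain ⟨p, q, hp⟩ := PTime.solve
  refine ⟨p, q, fun I hI => ?_⟩
  have hsp : I.IsSP Finset.univ Finset.univ I.s I.t := hI
  obtain ⟨r, -, -, hr⟩ := hsp.exists_rank
  obtain ⟨k, hk, hq⟩ := hp I.toInput
  unfold esize at hq
  rw [I.enc_toInput] at hk hq
  exact ⟨_, k, hk, hq, TwoStageInstance.isSolution_solve (fun a => hr a (Finset.mem_univ a))
    hsp.exists_isWalk⟩
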